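/- There are countable $\omega$-categorical structures $\mathcal A$ and $\mathcal B$ (with domain $\omega$, in countable relational languages) whose endomorphism monoids $\mathrm{End}(\mathcal A)$ and $\mathrm{End}(\mathcal B)$, with the topology of pointwise convergence, are isomorphic as abstract monoids but not as topological monoids. Moreover, $\mathcal A$ and $\mathcal B$ can be chosen such that $\Gamma:=\mathrm{Aut}(\mathcal A)$ and $\Delta:=\mathrm{Aut}(\mathcal B)$ are closed oligomorphic subgroups of $\mathrm{Sym}(\omega)$ which are isomorphic as abstract groups but not as topological groups, $\mathrm{End}(\mathcal A)$ and $\mathrm{End}(\mathcal B)$ are the closures of $\Gamma$ and $\Delta$ in $\omega^\omega$, and $\Gamma$, $\Delta$ arise as follows from a second countable profinite group $G$. (a) $G$ has a non-trivial finite central subgroup $F$ with a dense complement $F'$ (that is, $G=F\cdot F'$ and $F\cap F'=1$), and every complement of every finite central subgroup of $G$ is dense in $G$. Moreover, $G_0$ is an open normal subgroup of $G$ with $G_0\cap F=1$, and $\iota\colon G/F\to\prod_{n\ge 1}\mathrm{Sym}(n)$ is an injective continuous homomorphism. (b) $M$ is the Fraïssé limit, with domain $\omega$, of the class of all finite structures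 with $n$-ary relations $P^n_1,\dots,P^n_n$ for every $n\ge1$ such that, for every $n$, each $n$-tuple with distinct entries satisfies exactly one of $P^n_1,\dots,P^n_n$, and no other $n$-tuple satisfies any of them. $\Sigma_{G/F}$ is the group of all permutations $g$ of $M$ for which there is some $r\in G/F$ such that $g$ maps $P^n_i$ onto $P^n_{\iota(r)_n(i)}$ for all $1\le i\le n$; one says that $g$ induces $r$. (c) $\Sigma_{G/F}$ acts on the disjoint union of $M$ and $G/G_0$: an element $g$ that induces $r\in G/F$ acts on $M$ as $g$, and on $G/G_0$ as left translation by the unique element of $F'$ in the coset $r$. After identification of this countable set with $\omega$ by a bijection, $\Gamma$ is the closure in $\mathrm{Sym}(\omega)$ of the permutation group induced by this action. (d) $\Delta$ is topologically isomorphic to $\Sigma_{G/F}\times F$. -/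

import Mathlib

open scoped FirstOrder Cardinal

/-! ### Transformation monoids and permutation groups as topological objects -/

/-- The topology of pointwise convergence on the monoid `X → X` of all transformations of `X`:
the product topology, where `X` is discrete. -/
instance Function.End.pointwiseTopology (X : Type*) : TopologicalSpace (Function.End X) :=
  @Pi.topologicalSpace X (fun _ => X) (fun _ => ⊥)

/-- A permutation of `X` seen as a transformation of `X`. -/
def permToEnd {X : Type*} (g : Equiv.Perm X) : Function.End X := fun x => g x

/-- The topology of pointwise convergence on `Sym(X)`: the subspace topology from `X → X`. -/
instance Equiv.Perm.pointwiseTopology (X : Type*) : TopologicalSpace (Equiv.Perm X) :=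
  TopologicalSpace.induced permToEnd (Function.End.pointwiseTopology X)

/-- The closure of a permutation group in the space of all transformations of its domain. -/
def transClosure {X : Type*} (Θ : Subgroup (Equiv.Perm X)) : Set (Function.End X) :=
  closure (permToEnd '' (Θ : Set (Equiv.Perm X)))

/-- A permutation group on `X` is oligomorphic if for every `k` it has only finitely many orbits
in its componentwise action on `k`-tuples of elements of `X`. -/
def IsOligomorphic {X : Type*} (Θ : Subgroup (Equiv.Perm X)) : Prop :=
  ∀ k : ℕ, Finite (MulAction.orbitRel.Quotient Θ (Fin k → X))

/-! ### Endomorphism monoids, automorphism groups, countable categoricity -/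

/-- The endomorphism monoid of a structure, a submonoid of the monoid of all transformations. -/
def endMonoid (L : FirstOrder.Language) (M : Type*) [L.Structure M] : Submonoid (Function.End M) where
  carrier := {f | ∃ φ : M →[L] M, ∀ x, φ x = f x}
  one_mem' := ⟨FirstOrder.Language.Hom.id L M, fun _ => rfl⟩
  mul_mem' := by
    rintro f g ⟨φ, hφ⟩ ⟨ψ, hψ⟩
    refine ⟨φ.comp ψ, fun x => ?_⟩
    rw [FirstOrder.Language.Hom.comp_apply, hψ, hφ]
    rfl

/-- The automorphism group of a structure, a subgroup of the full symmetric group. -/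
def autGroup (L : FirstOrder.Language) (M : Type*) [L.Structure M] : Subgroup (Equiv.Perm M) where
  carrier := {g | ∃ φ : M ≃[L] M, ∀ x, φ x = g x}
  one_mem' := ⟨FirstOrder.Language.Equiv.refl L M, fun _ => rfl⟩
  mul_mem' := by
    rintro f g ⟨φ, hφ⟩ ⟨ψ, hψ⟩
    refine ⟨φ.comp ψ, fun x => ?_⟩
    rw [FirstOrder.Language.Equiv.comp_apply, hψ, hφ]
    rfl
  inv_mem' := by
    rintro g ⟨φ, hφ⟩
    refine ⟨φ.symm, fun x => ?_⟩
    apply φ.injective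
    rw [FirstOrder.Language.Equiv.apply_symm_apply, hφ]
    exact (Equiv.apply_symm_apply g x).symm

/-- A structure is `ω`-categorical if all countably infinite models of its first-order theory are
isomorphic. -/
def IsOmegaCategorical (L : FirstOrder.Language.{0, 0}) (M : Type) [L.Structure M] : Prop :=
  Cardinal.Categorical (ℵ₀ : Cardinal.{0}) (L.completeTheory M)

/-! ### The profinite group -/

/-- `F` is a non-trivial finite central subgroup of the topological group `G` with dense complement
`F'`, and any complement of any finite central subgroup of `G` is dense in `G`. -/
structure IsDenselyComplemented {G : Type*} [Group G] [TopologicalSpace G]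
    (F F' : Subgroup G) : Prop where
  nontrivial : F ≠ ⊥
  finite : Finite F
  central : F ≤ Subgroup.center G
  complement : Subgroup.IsComplement' F F'
  dense : Dense (F' : Set G)
  dense_of_complement : ∀ C C' : Subgroup G, Finite C → C ≤ Subgroup.center G →
    Subgroup.IsComplement' C C' → Dense (C' : Set G)

/-! ### The generic partitioned structure and the encoding of profinite groups -/

/-- The relational language with the `n`-ary relation symbols `P i`, for `i : Fin n`. -/
def partLang : FirstOrder.Language.{0, 0} := ⟨fun _ => Empty, fun n => Fin n⟩

instance (n : ℕ) : IsEmpty (partLang.Functions n) := inferInstanceAs (IsEmpty Empty)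

/-- The `n`-ary relation symbol with index `i : Fin n`. -/
def partRel {n : ℕ} (i : Fin n) : partLang.Relations n := i

/-- The class of all finite structures in which, for every `n ≥ 1`, the `n`-ary relations partition
the set of all `n`-tuples with distinct entries. -/
def partClass : Set (CategoryTheory.Bundled.{0} partLang.Structure) :=
  {N | Finite N ∧
    (∀ (n : ℕ) (i : Fin n) (x : Fin n → N),
      FirstOrder.Language.Structure.RelMap (partRel i) x → Function.Injective x) ∧
    (∀ n : ℕ, 1 ≤ n → ∀ x : Fin n → N, Function.Injective x →
      ∃! i : Fin n, FirstOrder.Language.Structure.RelMap (partRel i) x)}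

/-- The permutation `g` of `M` induces, for every `n`, the permutation `σ n` on the set of the
`n`-ary relations. -/
def Induces {M : Type*} [partLang.Structure M] (g : Equiv.Perm M)
    (σ : ∀ n : ℕ, Equiv.Perm (Fin n)) : Prop :=
  ∀ (n : ℕ) (i : Fin n) (x : Fin n → M),
    FirstOrder.Language.Structure.RelMap (partRel (σ n i)) (fun j => g (x j)) ↔
      FirstOrder.Language.Structure.RelMap (partRel i) x

theorem Induces.one {M : Type*} [partLang.Structure M] : Induces (1 : Equiv.Perm M) 1 :=
  fun _ _ _ => Iff.rfl

theorem Induces.mul {M : Type*} [partLang.Structure M] {g h : Equiv.Perm M}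
    {σ τ : ∀ n : ℕ, Equiv.Perm (Fin n)} (hg : Induces g σ) (hh : Induces h τ) :
    Induces (g * h) (σ * τ) :=
  fun n i x => (hg n (τ n i) (fun j => h (x j))).trans (hh n i x)

theorem Induces.inv {M : Type*} [partLang.Structure M] {g : Equiv.Perm M}
    {σ : ∀ n : ℕ, Equiv.Perm (Fin n)} (hg : Induces g σ) : Induces g⁻¹ σ⁻¹ := by
  intro n i x
  have h := hg n ((σ n).symm i) (fun j => g.symm (x j))
  simp only [Equiv.apply_symm_apply] at h
  exact h.symm

/-- Given a representation `ι` of `R` in `∏ₙ Sym(n)`, the group of all permutations of `M` that act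
on the relations like an element of `ι(R)`, that is, the preimage of `ι(R)` under the homomorphism
that sends a permutation to the permutation of the relations it induces. -/
def encodingGroup (M : Type*) [partLang.Structure M] {R : Type*} [Group R]
    (ι : R →* ∀ n : ℕ, Equiv.Perm (Fin n)) : Subgroup (Equiv.Perm M) where
  carrier := {g | ∃ r : R, Induces g (ι r)}
  one_mem' := ⟨1, by rw [map_one]; exact Induces.one⟩
  mul_mem' := by
    rintro g h ⟨r, hr⟩ ⟨s, hs⟩
    exact ⟨r * s, by rw [map_mul]; exact hr.mul hs⟩
  inv_mem' := by
    rintro g ⟨r, hr⟩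
    exact ⟨r⁻¹, by rw [map_inv]; exact hr.inv⟩

/-- The image of the encoding group of `G ⧸ F` in its action on the disjoint union of `M` and
`G ⧸ G₀`: an element `g` of the encoding group which induces `r` in `G ⧸ F` acts on `M` as `g`, and
on `G ⧸ G₀` by left translation with the element `f` of `F'` (unique if `F'` is a complement of `F`)
whose class is `r`. -/
def twistedGroup (M : Type*) [partLang.Structure M] {G : Type*} [Group G] (F F' G₀ : Subgroup G)
    [F.Normal] (ι : G ⧸ F →* ∀ n : ℕ, Equiv.Perm (Fin n)) :
    Subgroup (Equiv.Perm (M ⊕ (G ⧸ G₀))) where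
  carrier := {p | ∃ (g : Equiv.Perm M) (f : G), f ∈ F' ∧ Induces g (ι (QuotientGroup.mk f)) ∧
    p = Equiv.sumCongr g (MulAction.toPerm f)}
  one_mem' := by
    refine ⟨1, 1, F'.one_mem, ?_, ?_⟩
    · rw [QuotientGroup.mk_one, map_one]
      exact Induces.one
    · ext (x | x) <;> simp
  mul_mem' := by
    rintro p q ⟨g, f, hf, hg, rfl⟩ ⟨g', f', hf', hg', rfl⟩
    refine ⟨g * g', f * f', F'.mul_mem hf hf', ?_, ?_⟩
    · rw [QuotientGroup.mk_mul, map_mul]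
      exact hg.mul hg'
    · ext (x | x) <;> simp [mul_smul]
  inv_mem' := by
    rintro p ⟨g, f, hf, hg, rfl⟩
    refine ⟨g⁻¹, f⁻¹, F'.inv_mem hf, ?_, ?_⟩
    · rw [QuotientGroup.mk_inv, map_inv]
      exact hg.inv
    · rw [inv_eq_iff_mul_eq_one]
      ext (x | x) <;> simp

/-! The groups. Let `G` consist of the pairs of an infinite vector and an infinite strictly upper
triangular matrix over `ZMod 2`, with `(v, a) (w, b) = (v + w, a + b + (vᵢ wⱼ)_{i < j})`. Its centre
is the group of matrices. The matrix units are commutators, so a complement of a central subgroup,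
containing all commutators, is dense (`UpperGroup.dense_of_isComplement'`). The matrices
`(vᵢ wⱼ)_{i < j}` do not span `farMatrix`, whose rows differ arbitrarily far out, so a linear
functional kills the former and not the latter; its kernel is an abstract complement of the central
subgroup `F` of order two generated by `farMatrix`
(`UpperGroup.exists_isDenselyComplemented`).

The structures. The generic partitioned structure `M` has the one-point extension property
`IsGenericPart`. By back and forth, every finite partial map that permutes the relations by
`σ ∈ ∏ₙ Sym(n)` extends to a permutation inducing `σ` (`exists_perm_extending`). For a compact group
`H`, a continuous `ρ : H → ∏ₙ Sym(n)` and an action `κ` of `H` with open kernel on a finite set `Q`,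
the group `coverGroup ρ κ M` acts on `M ⊕ Q`; it consists of the pairs `(g, h)` where `g` induces
`ρ h`. Compactness and the extension of partial maps show that its closure in the space of all
transformations consists of the analogous pairs with a transformation in place of `g`, and that the
pairs over a dense subset of `H` are dense in it (`closure_cover`). As an abstract monoid this
closure depends only on the abstract group `H` over `∏ₙ Sym(n)` (`fiberMonoidCongr`). Now `Γ` is the cover
for `H = G`, `Q = G ⧸ G₀`, and `Δ` that for `H = (G ⧸ F) × F`, `Q = F`. The complement of `F` makes
these two groups `H` abstractly isomorphic over `G ⧸ F`, and `Δ` is the product of the encoding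
group and `F`.

No topological isomorphism exists (`isEmpty_coverGroup_equiv_prod`). The automorphism group of `M`
has no proper normal subgroup containing the pointwise stabiliser of a finite set
(`mem_of_stabilizer_le`), so it lies in the kernel of every continuous homomorphism from `Γ` to a
finite group. Hence a topological splitting of `F` off `Γ` would induce an open proper complement of
a finite central subgroup of `G`, while all such complements are dense. The same follows for the
endomorphism monoids, whose groups of units are the automorphism groups (`autGroupEquivUnits`).

Finally, a closed oligomorphic group is the automorphism group of the structure of its orbits on
tuples; the endomorphisms of that structure form the closure of the group (`endMonoid_orbit`), and
it is `ω`-categorical since in every model of its theory the orbit symbol satisfied by a tuple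
determines the type of the tuple (`isOmegaCategorical_orbit`). -/

/-! ### Back and forth -/

/-- Back and forth with finite partial maps given by lists of pairs: if every good list can be
extended at every source and at every target, then every good list is contained in the graph of a
bijection that is, on every finite set, given by a good list. -/
theorem exists_equiv_of_backAndForth {X Y : Type*} [Countable X] [Countable Y]
    (R : List (X × Y) → Prop)
    (hfun : ∀ l, R l → ∀ p ∈ l, ∀ q ∈ l, p.1 = q.1 ↔ p.2 = q.2)
    (forth : ∀ l, R l → ∀ x, ∃ y, R ((x, y) :: l))
    (back : ∀ l, R l → ∀ y, ∃ x, R ((x, y) :: l))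
    (l₀ : List (X × Y)) (h₀ : R l₀) :
    ∃ e : X ≃ Y, (∀ p ∈ l₀, e p.1 = p.2) ∧
      ∀ s : Finset X, ∃ l, R l ∧ ∀ x ∈ s, (x, e x) ∈ l := by
  classical
  obtain ⟨task, htask⟩ := exists_surjective_nat (Option (X ⊕ Y))
  have step : ∀ (l : {l // R l}) (t : Option (X ⊕ Y)), ∃ l' : {l // R l}, l.1 ⊆ l'.1 ∧
      (∀ x, t = some (Sum.inl x) → ∃ y, (x, y) ∈ l'.1) ∧
      (∀ y, t = some (Sum.inr y) → ∃ x, (x, y) ∈ l'.1) := by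
    rintro ⟨l, hl⟩ (_ | x | y)
    · exact ⟨⟨l, hl⟩, List.Subset.refl _, by simp, by simp⟩
    · obtain ⟨y, hy⟩ := forth l hl x
      refine ⟨⟨_, hy⟩, List.subset_cons_self _ _, ?_, by simp⟩
      rintro _ ⟨⟩
      exact ⟨y, by simp⟩
    · obtain ⟨x, hx⟩ := back l hl y
      refine ⟨⟨_, hx⟩, List.subset_cons_self _ _, by simp, ?_⟩
      rintro _ ⟨⟩
      exact ⟨x, by simp⟩
  choose next hsub hX hY using step
  let seq : ℕ → {l // R l} := fun n => Nat.rec ⟨l₀, h₀⟩ (fun k l => next l (task k)) n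
  have hmono : ∀ m n, m ≤ n → (seq m).1 ⊆ (seq n).1 := by
    intro m n h
    induction h with
    | refl => exact List.Subset.refl _
    | step _ ih => exact List.Subset.trans ih (hsub _ _)
  have hx : ∀ x, ∃ y n, (x, y) ∈ (seq n).1 := fun x => by
    obtain ⟨k, hk⟩ := htask (some (Sum.inl x))
    obtain ⟨y, hy⟩ := hX (seq k) (task k) x hk
    exact ⟨y, k + 1, hy⟩
  have hy : ∀ y, ∃ x n, (x, y) ∈ (seq n).1 := fun y => by
    obtain ⟨k, hk⟩ := htask (some (Sum.inr y))
    obtain ⟨x, hx⟩ := hY (seq k) (task k) y hk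
    exact ⟨x, k + 1, hx⟩
  have hiff : ∀ {m n p q}, p ∈ (seq m).1 → q ∈ (seq n).1 → (p.1 = q.1 ↔ p.2 = q.2) :=
    fun {m n p q} hp hq => hfun _ (seq (max m n)).2 p (hmono _ _ (le_max_left _ _) hp) q
      (hmono _ _ (le_max_right _ _) hq)
  choose f nf hf using hx
  choose g ng hg using hy
  refine ⟨⟨f, g, fun x => ?_, fun y => ?_⟩, fun p hp => ?_, fun s => ?_⟩
  · exact (hiff (hg (f x)) (hf x)).2 rfl
  · exact (hiff (hf (g y)) (hg y)).1 rfl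
  · exact (hiff (m := nf p.1) (n := 0) (hf p.1) hp).1 rfl
  · refine ⟨_, (seq (s.sup nf)).2, fun x hx => ?_⟩
    exact hmono _ _ (Finset.le_sup hx) (hf x)

/-! ### Closures in the topology of pointwise convergence -/

theorem isOpen_setOf_agree {X : Type*} (f : X → X) (s : Finset X) :
    IsOpen {g : Function.End X | ∀ x ∈ s, g x = f x} := by
  let _ : TopologicalSpace X := ⊥
  have : DiscreteTopology X := ⟨rfl⟩
  have h : {g : Function.End X | ∀ x ∈ s, g x = f x} =
      (Set.pi (s : Set X) fun x => {f x} : Set (X → X)) := by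
    ext g
    rfl
  rw [h]
  exact isOpen_set_pi s.finite_toSet fun x _ => isOpen_discrete _

theorem exists_finset_agree_subset {X : Type*} {U : Set (Function.End X)} (hU : IsOpen U)
    {f : Function.End X} (hf : f ∈ U) : ∃ s : Finset X, ∀ g : Function.End X,
      (∀ x ∈ s, g x = f x) → g ∈ U := by
  let _ : TopologicalSpace X := ⊥
  obtain ⟨s, u, hu, hs⟩ := isOpen_pi_iff.1 (show @IsOpen (X → X) _ U from hU) f hf
  exact ⟨s, fun g hg => hs fun x hx => by rw [hg x hx]; exact (hu x hx).2⟩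

theorem mem_closure_pointwise_iff {X : Type*} {S : Set (Function.End X)} {f : Function.End X} :
    f ∈ closure S ↔ ∀ s : Finset X, ∃ g ∈ S, ∀ x ∈ s, g x = f x := by
  rw [mem_closure_iff]
  constructor
  · intro h s
    obtain ⟨g, hg, hgS⟩ := h _ (isOpen_setOf_agree f s) fun x _ => rfl
    exact ⟨g, hgS, hg⟩
  · intro h U hU hf
    obtain ⟨s, hs⟩ := exists_finset_agree_subset hU hf
    obtain ⟨g, hg, hgs⟩ := h s
    exact ⟨g, hs g hgs, hg⟩

/-! ### The canonical structure of a closed oligomorphic group -/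

/-- The language of the canonical structure of a permutation group: an `n`-ary relation symbol for
every orbit on `n`-tuples. -/
def orbitLang (Θ : Subgroup (Equiv.Perm ℕ)) : FirstOrder.Language.{0, 0} :=
  ⟨fun _ => Empty, fun n => MulAction.orbitRel.Quotient Θ (Fin n → ℕ)⟩

/-- The orbit of a tuple, as a relation symbol. -/
def orbitSymbol (Θ : Subgroup (Equiv.Perm ℕ)) {n : ℕ} (x : Fin n → ℕ) :
    (orbitLang Θ).Relations n :=
  (Quotient.mk _ x : MulAction.orbitRel.Quotient Θ (Fin n → ℕ))

instance (Θ : Subgroup (Equiv.Perm ℕ)) (n : ℕ) : IsEmpty ((orbitLang Θ).Functions n) :=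
  inferInstanceAs (IsEmpty Empty)

/-- The canonical structure of a permutation group, in which every orbit on tuples is a relation. -/
instance orbitStructure (Θ : Subgroup (Equiv.Perm ℕ)) : (orbitLang Θ).Structure ℕ where
  funMap f := isEmptyElim f
  RelMap O x := orbitSymbol Θ x = O

section Canonical

open FirstOrder FirstOrder.Language

variable {Θ : Subgroup (Equiv.Perm ℕ)}

theorem orbitSymbol_eq_iff {n : ℕ} {x y : Fin n → ℕ} :
    orbitSymbol Θ x = orbitSymbol Θ y ↔ ∃ g ∈ Θ, ∀ i, g (y i) = x i := by
  have : orbitSymbol Θ x = orbitSymbol Θ y ↔ x ∈ MulAction.orbit Θ y :=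
    (Quotient.eq (r := MulAction.orbitRel Θ (Fin n → ℕ))).trans Iff.rfl
  rw [this]
  constructor
  · rintro ⟨g, rfl⟩
    exact ⟨g.1, g.2, fun i => rfl⟩
  · rintro ⟨g, hg, h⟩
    exact ⟨⟨g, hg⟩, funext h⟩

theorem exists_orbitSymbol_eq {n : ℕ} (O : (orbitLang Θ).Relations n) :
    ∃ x : Fin n → ℕ, orbitSymbol Θ x = O :=
  Quotient.exists_rep O

theorem relMap_orbit {n : ℕ} {O : (orbitLang Θ).Relations n} {x : Fin n → ℕ} :
    Structure.RelMap O x ↔ orbitSymbol Θ x = O := Iff.rfl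

/-- Every element of a permutation group is an automorphism of its canonical structure. -/
def orbitEquiv (g : Equiv.Perm ℕ) (hg : g ∈ Θ) : ℕ ≃[orbitLang Θ] ℕ where
  toEquiv := g
  map_fun' f := isEmptyElim f
  map_rel' {n} O x := by
    rw [relMap_orbit, relMap_orbit]
    have : orbitSymbol Θ (g ∘ x) = orbitSymbol Θ x := orbitSymbol_eq_iff.2 ⟨g, hg, fun i => rfl⟩
    exact this ▸ Iff.rfl

theorem mem_transClosure_iff {X : Type*} {Θ : Subgroup (Equiv.Perm X)} {f : Function.End X} :
    f ∈ transClosure Θ ↔ ∀ s : Finset X, ∃ g ∈ Θ, ∀ x ∈ s, g x = f x := by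
  simp only [transClosure, mem_closure_pointwise_iff, Set.exists_mem_image]
  rfl

/-- The endomorphisms of the canonical structure are the transformations that agree with members of
the group on every finite set. -/
theorem endMonoid_orbit : (endMonoid (orbitLang Θ) ℕ : Set (Function.End ℕ)) = transClosure Θ := by
  ext f
  rw [mem_transClosure_iff]
  constructor
  · rintro ⟨φ, hφ⟩ s
    let x : Fin s.card → ℕ := fun i => s.equivFin.symm i
    have h : orbitSymbol Θ (φ ∘ x) = orbitSymbol Θ x := φ.map_rel (orbitSymbol Θ x) x rfl
    obtain ⟨g, hg, hgx⟩ := orbitSymbol_eq_iff.1 h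
    refine ⟨g, hg, fun a ha => ?_⟩
    have := hgx (s.equivFin ⟨a, ha⟩)
    simp only [x, Function.comp_apply, Equiv.symm_apply_apply] at this
    rw [this, hφ]
  · intro h
    refine ⟨⟨f, fun F => isEmptyElim F, fun {n} O x hO => ?_⟩, fun _ => rfl⟩
    obtain ⟨g, hg, hgx⟩ := h (Finset.univ.image x)
    rw [relMap_orbit] at hO ⊢
    rw [← hO]
    exact orbitSymbol_eq_iff.2 ⟨g, hg, fun i => hgx _ (by simp)⟩

theorem mem_closure_perm_iff {X : Type*} {T : Set (Equiv.Perm X)} {p : Equiv.Perm X} :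
    p ∈ closure T ↔ permToEnd p ∈ closure (permToEnd '' T) := by
  have h : Topology.IsInducing (permToEnd (X := X)) := ⟨rfl⟩
  rw [h.closure_eq_preimage_closure_image]
  rfl

theorem autGroup_orbit (hΘ : IsClosed (Θ : Set (Equiv.Perm ℕ))) :
    autGroup (orbitLang Θ) ℕ = Θ := by
  ext g
  constructor
  · rintro ⟨φ, hφ⟩
    have : permToEnd g ∈ (endMonoid (orbitLang Θ) ℕ : Set (Function.End ℕ)) :=
      ⟨φ.toHom, fun x => hφ x⟩
    rw [endMonoid_orbit] at this
    have := mem_closure_perm_iff.2 this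
    rwa [hΘ.closure_eq] at this
  · intro hg
    exact ⟨orbitEquiv g hg, fun x => rfl⟩

theorem realize_iff_of_orbitSymbol_eq {n : ℕ} (φ : (orbitLang Θ).Formula (Fin n)) {x y : Fin n → ℕ}
    (h : orbitSymbol Θ x = orbitSymbol Θ y) : φ.Realize x ↔ φ.Realize y := by
  obtain ⟨g, hg, hgx⟩ := orbitSymbol_eq_iff.1 h
  have : x = orbitEquiv g hg ∘ y := funext fun i => (hgx i).symm
  rw [this, StrongHomClass.realize_formula]

theorem forall_realize_iff {L : FirstOrder.Language.{0, 0}} {A N : Type} [L.Structure A]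
    [L.Structure N] [N ⊨ L.completeTheory A] {n : ℕ} (φ : L.Formula (Fin n)) :
    (∀ t : Fin n → N, φ.Realize t) ↔ ∀ a : Fin n → A, φ.Realize a := by
  let ψ : L.Sentence := (φ.relabel (Sum.inr : Fin n → Empty ⊕ Fin n)).iAlls (Fin n)
  have key : ∀ (B : Type) [L.Structure B], B ⊨ ψ ↔ ∀ a : Fin n → B, φ.Realize a := by
    intro B _
    simp only [ψ, Sentence.Realize, Formula.realize_iAlls, Formula.realize_relabel]
    rfl
  rw [← key, ← key]
  exact realize_iff_of_model_completeTheory A N ψ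

section Model

variable {N : Type} [(orbitLang Θ).Structure N] [N ⊨ (orbitLang Θ).completeTheory ℕ]

/-- In a model of the theory of the canonical structure, the orbit symbol that a tuple satisfies
determines the complete type of the tuple. -/
theorem realize_iff_of_relMap {n : ℕ} (φ : (orbitLang Θ).Formula (Fin n)) {t : Fin n → N}
    {a : Fin n → ℕ} (h : Structure.RelMap (orbitSymbol Θ a) t) : φ.Realize t ↔ φ.Realize a := by
  let ρ : (orbitLang Θ).Formula (Fin n) := (orbitSymbol Θ a).formula Term.var
  have hρ : ∀ (B : Type) [(orbitLang Θ).Structure B] (s : Fin n → B),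
      ρ.Realize s ↔ Structure.RelMap (orbitSymbol Θ a) s := by
    intro B _ s
    simp only [ρ, Formula.realize_rel, Term.realize_var]
  by_cases ha : φ.Realize a
  · refine iff_of_true ?_ ha
    have := (forall_realize_iff (A := ℕ) (N := N) (ρ.imp φ)).2 fun b => by
      rw [Formula.realize_imp, hρ]
      intro hb
      exact (realize_iff_of_orbitSymbol_eq φ hb).2 ha
    exact (Formula.realize_imp.1 (this t)) ((hρ N t).2 h)
  · refine iff_of_false ?_ ha
    have := (forall_realize_iff (A := ℕ) (N := N) (ρ.imp φ.not)).2 fun b => by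
      rw [Formula.realize_imp, hρ, Formula.realize_not]
      intro hb
      exact fun hb' => ha ((realize_iff_of_orbitSymbol_eq φ hb).1 hb')
    exact Formula.realize_not.1 ((Formula.realize_imp.1 (this t)) ((hρ N t).2 h))

theorem exists_relMap_orbitSymbol (hΘ : IsOligomorphic Θ) {n : ℕ} (t : Fin n → N) :
    ∃ a : Fin n → ℕ, Structure.RelMap (orbitSymbol Θ a) t := by
  have : Finite ((orbitLang Θ).Relations n) := hΘ n
  have := (forall_realize_iff (A := ℕ) (N := N) (n := n) (BoundedFormula.iSup
    fun O : (orbitLang Θ).Relations n => O.formula Term.var)).2 fun b => by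
      rw [Formula.Realize, BoundedFormula.realize_iSup]
      exact ⟨orbitSymbol Θ b, Formula.realize_rel.2 rfl⟩
  have := this t
  rw [Formula.Realize, BoundedFormula.realize_iSup] at this
  obtain ⟨O, hO⟩ := this
  obtain ⟨a, rfl⟩ := exists_orbitSymbol_eq O
  exact ⟨a, Formula.realize_rel.1 hO⟩

end Model

/-- The pairs in the list are among the entries of a pair of tuples satisfying the same orbit
symbol, hence having the same complete type. -/
def SameOrbit (Θ : Subgroup (Equiv.Perm ℕ)) {N N' : Type} [(orbitLang Θ).Structure N]
    [(orbitLang Θ).Structure N'] (l : List (N × N')) : Prop :=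
  ∃ (n : ℕ) (p : Fin n → N × N') (a : Fin n → ℕ),
    Structure.RelMap (orbitSymbol Θ a) (fun i => (p i).1) ∧
    Structure.RelMap (orbitSymbol Θ a) (fun i => (p i).2) ∧ ∀ q ∈ l, ∃ i, p i = q

theorem SameOrbit.swap {N N' : Type} [(orbitLang Θ).Structure N]
    [(orbitLang Θ).Structure N'] {l : List (N × N')} (h : SameOrbit Θ l) :
    SameOrbit Θ (l.map Prod.swap) := by
  obtain ⟨n, p, a, h1, h2, h⟩ := h
  refine ⟨n, fun i => (p i).swap, a, h2, h1, fun q hq => ?_⟩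
  obtain ⟨r, hr, rfl⟩ := List.mem_map.1 hq
  obtain ⟨i, rfl⟩ := h r hr
  exact ⟨i, rfl⟩

theorem SameOrbit.forth (hΘ : IsOligomorphic Θ) {N N' : Type} [(orbitLang Θ).Structure N]
    [(orbitLang Θ).Structure N'] [N ⊨ (orbitLang Θ).completeTheory ℕ]
    [N' ⊨ (orbitLang Θ).completeTheory ℕ] {l : List (N × N')} (h : SameOrbit Θ l) (x : N) :
    ∃ y, SameOrbit Θ ((x, y) :: l) := by
  obtain ⟨n, p, b, h1, h2, h⟩ := h
  obtain ⟨a, ha⟩ :=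
    exists_relMap_orbitSymbol hΘ (Fin.cons x (fun i => (p i).1) : Fin (n + 1) → N)
  -- the formula saying that the tuple can be extended to one satisfying the orbit symbol of `a`
  let φ : (orbitLang Θ).Formula (Fin n) := Formula.iExs Unit
    ((orbitSymbol Θ a).formula fun i : Fin (n + 1) =>
      Term.var (Fin.cases (Sum.inr ()) Sum.inl i : Fin n ⊕ Unit))
  have hφ : ∀ (B : Type) [(orbitLang Θ).Structure B] (s : Fin n → B),
      φ.Realize s ↔ ∃ y, Structure.RelMap (orbitSymbol Θ a) (Fin.cons y s : Fin (n + 1) → B) := by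
    intro B _ s
    simp only [φ, Formula.realize_iExs, Formula.realize_rel, Term.realize_var]
    have : ∀ i : Unit → B, (fun j : Fin (n + 1) => Sum.elim s i
        (Fin.cases (Sum.inr ()) Sum.inl j : Fin n ⊕ Unit)) = Fin.cons (i ()) s := by
      intro i
      funext j
      refine Fin.cases ?_ (fun j => ?_) j <;> rfl
    simp only [this]
    exact ⟨fun ⟨i, hi⟩ => ⟨i (), hi⟩, fun ⟨y, hy⟩ => ⟨fun _ => y, hy⟩⟩
  obtain ⟨y, hy⟩ := (hφ N' _).1 (((realize_iff_of_relMap φ h1).trans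
    (realize_iff_of_relMap φ h2).symm).1 ((hφ N _).2 ⟨x, ha⟩))
  refine ⟨y, n + 1, Fin.cons (x, y) p, a, ?_, ?_, fun q hq => ?_⟩
  · convert ha using 1
    funext j
    refine Fin.cases ?_ (fun j => ?_) j <;> rfl
  · convert hy using 1
    funext j
    refine Fin.cases ?_ (fun j => ?_) j <;> rfl
  · rcases List.mem_cons.1 hq with rfl | hq
    · exact ⟨0, rfl⟩
    · obtain ⟨i, rfl⟩ := h q hq
      exact ⟨i.succ, rfl⟩

/-- The structure is `ω`-categorical, by back and forth between two countable models along tuples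
that satisfy the same orbit symbols. -/
theorem isOmegaCategorical_orbit (hΘ : IsOligomorphic Θ) : IsOmegaCategorical (orbitLang Θ) ℕ := by
  intro N N' hN hN'
  have : Countable N := Cardinal.mk_le_aleph0_iff.1 hN.le
  have : Countable N' := Cardinal.mk_le_aleph0_iff.1 hN'.le
  have hfun : ∀ l : List (N × N'), SameOrbit Θ l → ∀ q ∈ l, ∀ r ∈ l, q.1 = r.1 ↔ q.2 = r.2 := by
    rintro l ⟨m, p, a, h1, h2, hl⟩ q hq r hr
    obtain ⟨i, rfl⟩ := hl q hq
    obtain ⟨j, rfl⟩ := hl r hr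
    have := (realize_iff_of_relMap (Term.equal (Term.var i) (Term.var j)) h1).trans
      (realize_iff_of_relMap _ h2).symm
    simpa only [Formula.realize_equal, Term.realize_var] using this
  have hback : ∀ l : List (N × N'), SameOrbit Θ l → ∀ y, ∃ x, SameOrbit Θ ((x, y) :: l) := by
    intro l hl y
    obtain ⟨x, hx⟩ := hl.swap.forth hΘ y
    have := hx.swap
    exact ⟨x, by simpa using this⟩
  have hnil : SameOrbit Θ ([] : List (N × N')) := by
    obtain ⟨a, ha⟩ := exists_relMap_orbitSymbol hΘ (fun i : Fin 0 => (i.elim0 : N))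
    obtain ⟨b, hb⟩ := exists_relMap_orbitSymbol hΘ (fun i : Fin 0 => (i.elim0 : N'))
    rw [Subsingleton.elim b a] at hb
    refine ⟨0, fun i => i.elim0, a, ?_, ?_, by simp⟩
    · convert ha
    · convert hb
  obtain ⟨e, -, he⟩ := exists_equiv_of_backAndForth (SameOrbit Θ) hfun
    (fun l h x => h.forth hΘ x) hback [] hnil
  refine ⟨⟨e, fun F => isEmptyElim F, fun {n} O x => ?_⟩⟩
  obtain ⟨l, ⟨m, p, a, h1, h2, hl⟩, hx⟩ := he (Set.finite_range x).toFinset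
  have : ∀ i, ∃ j, p j = (x i, e (x i)) := fun i => hl _ (hx (x i) (by simp))
  choose idx hidx using this
  have := (realize_iff_of_relMap (O.formula fun i => Term.var (idx i)) h1).trans
    (realize_iff_of_relMap _ h2).symm
  simp only [Formula.realize_rel, Term.realize_var, hidx] at this
  exact this.symm

theorem isRelational_orbitLang (Θ : Subgroup (Equiv.Perm ℕ)) : (orbitLang Θ).IsRelational :=
  fun _ => inferInstanceAs (IsEmpty Empty)

theorem countable_orbitLang (hΘ : IsOligomorphic Θ) : Countable (orbitLang Θ).Symbols := by
  have : ∀ n, Countable ((orbitLang Θ).Relations n) := fun n =>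
    have : Finite ((orbitLang Θ).Relations n) := hΘ n
    inferInstance
  unfold FirstOrder.Language.Symbols
  infer_instance

end Canonical

/-! ### Generic partitioned structures -/

open FirstOrder.Language in
/-- A structure whose `n`-ary relations partition the injective `n`-tuples and that realises every
one-point extension: whenever colours `c n x % n` are prescribed for the tuples `x` consisting of a
new point `none` and of elements of a finite set `A`, there is a point outside `A` for which the
tuples have the prescribed colours. -/
class IsGenericPart (M : Type) [partLang.Structure M] : Prop where
  injective_of_rel : ∀ {n : ℕ} {i : Fin n} {x : Fin n → M},
    Structure.RelMap (partRel i) x → Function.Injective x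
  existsUnique_rel : ∀ {n : ℕ}, 1 ≤ n → ∀ {x : Fin n → M}, Function.Injective x →
    ∃! i : Fin n, Structure.RelMap (partRel i) x
  exists_point : ∀ (A : Finset M) (c : ∀ n, (Fin n → Option M) → ℕ), ∃ m ∉ A,
    ∀ (n : ℕ) (i : Fin n) (x : Fin n → Option M), Function.Injective x →
      (∀ j, ∀ a ∈ x j, a ∈ A) → (∃ j, x j = none) →
      (Structure.RelMap (partRel i) (fun j => (x j).getD m) ↔ (i : ℕ) = c n x % n)

section Generic

open FirstOrder.Language

variable {M : Type} [partLang.Structure M]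

/-- The index of the relation satisfied by a tuple, and `0` if there is none. -/
noncomputable def color {n : ℕ} (x : Fin n → M) : ℕ :=
  open Classical in if h : ∃ i : Fin n, Structure.RelMap (partRel i) x then h.choose else 0

theorem color_lt {n : ℕ} (hn : 0 < n) (x : Fin n → M) : color x < n := by
  unfold color
  split_ifs with h
  · exact h.choose.2
  · exact hn

theorem injective_pair {α : Type*} {a b : α} : Function.Injective ![a, b] ↔ a ≠ b := by
  constructor
  · intro h hab
    exact absurd (@h 0 1 hab) (by decide)
  · intro h i j hij
    fin_cases i <;> fin_cases j <;> simp_all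

/-- The list of pairs is a partial map that permutes the relations as `σ` does. -/
def PartialInduces (σ : ∀ n : ℕ, Equiv.Perm (Fin n)) (l : List (M × M)) : Prop :=
  ∀ (n : ℕ) (i : Fin n) (x : Fin n → M × M), (∀ j, x j ∈ l) →
    (Structure.RelMap (partRel (σ n i)) (fun j => (x j).2) ↔
      Structure.RelMap (partRel i) (fun j => (x j).1))

theorem PartialInduces.swap {σ : ∀ n : ℕ, Equiv.Perm (Fin n)} {l : List (M × M)}
    (h : PartialInduces σ l) : PartialInduces σ⁻¹ (l.map Prod.swap) := by
  intro n i x hx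
  have := h n (σ⁻¹ n i) (fun j => (x j).swap) (fun j => by
    obtain ⟨p, hp, hpx⟩ := List.mem_map.1 (hx j)
    rwa [← hpx, Prod.swap_swap])
  simpa using this.symm

variable [IsGenericPart M]

theorem rel_iff_color {n : ℕ} {i : Fin n} {x : Fin n → M} :
    Structure.RelMap (partRel i) x ↔ Function.Injective x ∧ (i : ℕ) = color x := by
  have hu : ∀ {i' : Fin n}, Structure.RelMap (partRel i') x → (i' : ℕ) = color x := by
    intro i' hi
    have h : ∃ i : Fin n, Structure.RelMap (partRel i) x := ⟨i', hi⟩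
    rw [color, dif_pos h, (IsGenericPart.existsUnique_rel (by have := i'.2; omega)
      (IsGenericPart.injective_of_rel hi)).unique hi h.choose_spec]
  refine ⟨fun hi => ⟨IsGenericPart.injective_of_rel hi, hu hi⟩, fun ⟨hx, hi⟩ => ?_⟩
  obtain ⟨i', hi', -⟩ := IsGenericPart.existsUnique_rel (by have := i.2; omega) hx
  rwa [Fin.ext (hi.trans (hu hi').symm)]

theorem injective_iff_exists_rel {n : ℕ} (hn : 1 ≤ n) {x : Fin n → M} :
    Function.Injective x ↔ ∃ i : Fin n, Structure.RelMap (partRel i) x :=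
  ⟨fun h => (IsGenericPart.existsUnique_rel hn h).exists,
    fun ⟨_, h⟩ => IsGenericPart.injective_of_rel h⟩

theorem PartialInduces.fst_eq_iff {σ : ∀ n : ℕ, Equiv.Perm (Fin n)} {l : List (M × M)}
    (h : PartialInduces σ l) : ∀ p ∈ l, ∀ q ∈ l, p.1 = q.1 ↔ p.2 = q.2 := by
  intro p hp q hq
  have h2 : ∀ i : Fin 2, _ := fun i => h 2 i ![p, q] (by intro j; fin_cases j <;> simpa)
  have h1 : (fun j => (![p, q] j).1) = ![p.1, q.1] := by ext j; fin_cases j <;> rfl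
  have h1' : (fun j => (![p, q] j).2) = ![p.2, q.2] := by ext j; fin_cases j <;> rfl
  rw [← not_iff_not, ← ne_eq, ← ne_eq, ← injective_pair, ← injective_pair,
    injective_iff_exists_rel one_le_two, injective_iff_exists_rel one_le_two]
  simp only [h1, h1'] at h2
  simp only [← h2]
  exact (σ 2).exists_congr_left.trans (by simp)

theorem PartialInduces.forth {σ : ∀ n : ℕ, Equiv.Perm (Fin n)} {l : List (M × M)}
    (h : PartialInduces σ l) (a : M) : ∃ b, PartialInduces σ ((a, b) :: l) := by
  classical
  by_cases ha : ∃ b, (a, b) ∈ l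
  · obtain ⟨b, hb⟩ := ha
    refine ⟨b, fun n i x hx => h n i x fun j => ?_⟩
    rcases List.mem_cons.1 (hx j) with hj | hj
    · rwa [hj]
    · exact hj
  -- the partial inverse of the given partial map, with the new point sent to `a`
  let inv : Option M → M := fun o => o.elim a fun b =>
    if h : ∃ a', (a', b) ∈ l then h.choose else a
  have hinv : ∀ p ∈ l, inv (some p.2) = p.1 := by
    intro p hp
    have hex : ∃ a', (a', p.2) ∈ l := ⟨p.1, hp⟩
    have : inv (some p.2) = hex.choose := dif_pos hex
    rw [this]
    exact (h.fst_eq_iff _ hex.choose_spec _ hp).2 rfl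
  obtain ⟨b, hb, hext⟩ := IsGenericPart.exists_point (l.map Prod.snd).toFinset
    fun n x => if hn : 0 < n then σ n ⟨color (fun j => inv (x j)), color_lt hn _⟩ else 0
  have hb' : ∀ p ∈ l, p.2 ≠ b := fun p hp hpb => hb (by
    rw [List.mem_toFinset, ← hpb]
    exact List.mem_map_of_mem hp)
  have ha' : ∀ p ∈ l, p.1 ≠ a := fun p hp hpa => ha ⟨p.2, by rwa [← hpa]⟩
  have hfun : ∀ p ∈ (a, b) :: l, ∀ q ∈ (a, b) :: l, p.1 = q.1 ↔ p.2 = q.2 := by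
    intro p hp q hq
    rcases List.mem_cons.1 hp with rfl | hp' <;> rcases List.mem_cons.1 hq with rfl | hq'
    · simp
    · exact iff_of_false (ha' q hq').symm (hb' q hq').symm
    · exact iff_of_false (ha' p hp') (hb' p hp')
    · exact h.fst_eq_iff p hp' q hq'
  refine ⟨b, fun n i x hx => ?_⟩
  have hinj : Function.Injective (fun j => (x j).1) ↔ Function.Injective (fun j => (x j).2) :=
    forall₂_congr fun j k => imp_congr (hfun _ (hx j) _ (hx k)) Iff.rfl
  by_cases hi : Function.Injective fun j => (x j).1
  · by_cases hnew : ∃ j, x j = (a, b)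
    · let y : Fin n → Option M := fun j => if x j = (a, b) then none else some (x j).2
      have hy : ∀ j, (y j).getD b = (x j).2 := by
        intro j
        simp only [y]
        split_ifs with hj
        · simp [hj]
        · rfl
      have hy' : ∀ j, inv (y j) = (x j).1 := by
        intro j
        simp only [y]
        split_ifs with hj
        · simp [hj, inv]
        · exact hinv _ ((List.mem_cons.1 (hx j)).resolve_left hj)
      have hn : 0 < n := by have := i.2; omega
      have := hext n (σ n i) y (fun j k hjk => hi (by
          change (x j).1 = (x k).1
          rw [← hy', ← hy', hjk]))
        (fun j m hm => by
          simp only [y] at hm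
          split_ifs at hm with hj
          · simp at hm
          · obtain rfl : (x j).2 = m := by simpa using hm
            rw [List.mem_toFinset]
            exact List.mem_map_of_mem ((List.mem_cons.1 (hx j)).resolve_left hj))
        (by obtain ⟨j, hj⟩ := hnew; exact ⟨j, if_pos hj⟩)
      simp only [hy, hy', dif_pos hn] at this
      rw [this, Nat.mod_eq_of_lt (Fin.is_lt _), rel_iff_color, ← Fin.ext_iff,
        (σ n).apply_eq_iff_eq, Fin.ext_iff]
      exact (and_iff_right hi).symm
    · push Not at hnew
      exact h n i x fun j => (List.mem_cons.1 (hx j)).resolve_left (hnew j)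
  · exact iff_of_false (fun h' => hi (hinj.2 (IsGenericPart.injective_of_rel h')))
      (fun h' => hi (IsGenericPart.injective_of_rel h'))

/-- Every finite partial map that permutes the relations as `σ` does extends to a permutation
that induces `σ`. -/
theorem exists_perm_extending [Countable M] (σ : ∀ n : ℕ, Equiv.Perm (Fin n)) (s : Finset M)
    (f : M → M) (h : ∀ (n : ℕ) (i : Fin n) (x : Fin n → M), (∀ j, x j ∈ s) →
      (Structure.RelMap (partRel (σ n i)) (fun j => f (x j)) ↔ Structure.RelMap (partRel i) x)) :
    ∃ g : Equiv.Perm M, Induces g σ ∧ ∀ a ∈ s, g a = f a := by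
  obtain ⟨g, hg, hgl⟩ := exists_equiv_of_backAndForth (PartialInduces (M := M) σ)
    (fun l h => h.fst_eq_iff) (fun l h a => h.forth a)
    (fun l h b => by
      obtain ⟨a, ha⟩ := h.swap.forth b
      have := ha.swap
      exact ⟨a, by simpa using this⟩)
    (s.toList.map fun a => (a, f a))
    (by
      intro n i x hx
      have hx' : ∀ j, (x j).1 ∈ s ∧ (x j).2 = f (x j).1 := by
        intro j
        obtain ⟨a, ha, hxa⟩ := List.mem_map.1 (hx j)
        rw [← hxa]
        exact ⟨Finset.mem_toList.1 ha, rfl⟩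
      rw [← h n i _ fun j => (hx' j).1]
      simp only [(hx' _).2])
  refine ⟨g, fun n i x => ?_, fun a ha => ?_⟩
  · obtain ⟨l, hl, hlx⟩ := hgl (Set.finite_range x).toFinset
    exact hl n i (fun j => (x j, g (x j))) fun j => hlx _ (by simp)
  · exact hg (a, f a) (List.mem_map_of_mem (Finset.mem_toList.2 ha))

/-- Realisation of finitely many new points, indexed by `s`, over a finite set `A`, with
prescribed colours for the tuples that involve a new point. -/
theorem exists_points {I : Type*} (A : Finset M) (c : ∀ n, (Fin n → M ⊕ I) → ℕ) (s : Finset I) :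
    ∃ b : I → M, Set.InjOn b s ∧ (∀ k ∈ s, b k ∉ A) ∧
      ∀ (n : ℕ) (i : Fin n) (x : Fin n → M ⊕ I), Function.Injective x →
        (∀ j, ∀ a, x j = Sum.inl a → a ∈ A) → (∀ j, ∀ k, x j = Sum.inr k → k ∈ s) →
        (∃ j k, x j = Sum.inr k) →
        (Structure.RelMap (partRel i) (fun j => Sum.elim id b (x j)) ↔ (i : ℕ) = c n x % n) := by
  classical
  induction s using Finset.induction_on with
  | empty =>
    -- `b` is irrelevant, but `M` has to be non-empty
    obtain ⟨m, -⟩ := IsGenericPart.exists_point (∅ : Finset M) (fun _ _ => 0)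
    exact ⟨fun _ => m, by simp, by simp,
      fun n i x _ _ hr ⟨j, k, hjk⟩ => absurd (hr j k hjk) (by simp)⟩
  | insert k₀ s hk₀ ih =>
    obtain ⟨b, hinj, hbA, hb⟩ := ih
    -- reads a point of `A`, a point `b k` or the new point `none` as an element of `M ⊕ I`
    let dec : Option M → M ⊕ I := fun o => o.elim (Sum.inr k₀) fun a =>
      if h : ∃ k ∈ s, b k = a then Sum.inr h.choose else Sum.inl a
    have hdec_b : ∀ k ∈ s, dec (some (b k)) = Sum.inr k := by
      intro k hk
      have hex : ∃ k' ∈ s, b k' = b k := ⟨k, hk, rfl⟩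
      have : dec (some (b k)) = Sum.inr hex.choose := dif_pos hex
      rw [this, hinj hex.choose_spec.1 hk hex.choose_spec.2]
    have hdec_A : ∀ a ∈ A, dec (some a) = Sum.inl a := by
      intro a ha
      exact dif_neg fun ⟨k, hk, hka⟩ => hbA k hk (hka ▸ ha)
    obtain ⟨m, hm, hext⟩ := IsGenericPart.exists_point (A ∪ s.image b)
      fun n x => c n fun j => dec (x j)
    have hmA : m ∉ A := fun h => hm (Finset.mem_union_left _ h)
    have hms : ∀ k ∈ s, b k ≠ m := fun k hk h =>
      hm (Finset.mem_union_right _ (h ▸ Finset.mem_image_of_mem b hk))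
    have hne : ∀ k ∈ s, k ≠ k₀ := fun k hk h => hk₀ (h ▸ hk)
    have hupd : ∀ k ∈ s, Function.update b k₀ m k = b k := fun k hk =>
      Function.update_of_ne (hne k hk) _ _
    refine ⟨Function.update b k₀ m, ?_, ?_, ?_⟩
    · rw [Finset.coe_insert, Set.injOn_insert (by simpa using hk₀)]
      refine ⟨fun k hk l hl hkl => hinj hk hl ?_, ?_⟩
      · rwa [hupd k hk, hupd l hl] at hkl
      · rintro ⟨k, hk, hkm⟩
        rw [hupd k hk, Function.update_self] at hkm
        exact hms k hk hkm
    · intro k hk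
      rcases Finset.mem_insert.1 hk with rfl | hk
      · rwa [Function.update_self]
      · rw [hupd k hk]
        exact hbA k hk
    · intro n i x hx hxA hxs hnew
      by_cases hk : ∃ j, x j = Sum.inr k₀
      · let y : Fin n → Option M := fun j =>
          if x j = Sum.inr k₀ then none else some (Sum.elim id b (x j))
        have hcase : ∀ j, (x j = Sum.inr k₀ ∧ y j = none) ∨
            (∃ a ∈ A, x j = Sum.inl a ∧ y j = some a) ∨
            (∃ k ∈ s, x j = Sum.inr k ∧ y j = some (b k)) := by
          intro j
          by_cases hj : x j = Sum.inr k₀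
          · exact Or.inl ⟨hj, if_pos hj⟩
          · refine Or.inr ?_
            have hyj : y j = some (Sum.elim id b (x j)) := if_neg hj
            rcases hxj : x j with a | k
            · exact Or.inl ⟨a, hxA j a hxj, rfl, by rw [hyj, hxj]; rfl⟩
            · refine Or.inr ⟨k, (Finset.mem_insert.1 (hxs j k hxj)).resolve_left ?_, rfl,
                by rw [hyj, hxj]; rfl⟩
              rintro rfl
              exact hj hxj
        have hy : ∀ j, (y j).getD m = Sum.elim id (Function.update b k₀ m) (x j) := by
          intro j
          rcases hcase j with ⟨h1, h2⟩ | ⟨a, ha, h1, h2⟩ | ⟨k, hk, h1, h2⟩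
          · simp [h1, h2]
          · simp [h1, h2]
          · simp [h1, h2, hupd k hk]
        have hy' : ∀ j, dec (y j) = x j := by
          intro j
          rcases hcase j with ⟨h1, h2⟩ | ⟨a, ha, h1, h2⟩ | ⟨k, hk, h1, h2⟩
          · rw [h1, h2]; rfl
          · rw [h1, h2, hdec_A a ha]
          · rw [h1, h2, hdec_b k hk]
        have := hext n i y (fun j l hjl => hx (by rw [← hy', ← hy', hjl]))
          (fun j a ha => by
            rcases hcase j with ⟨h1, h2⟩ | ⟨a', ha', h1, h2⟩ | ⟨k, hk, h1, h2⟩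
            · simp [h2] at ha
            · obtain rfl : a' = a := by simpa [h2] using ha
              exact Finset.mem_union_left _ ha'
            · obtain rfl : b k = a := by simpa [h2] using ha
              exact Finset.mem_union_right _ (Finset.mem_image_of_mem b hk))
          (by obtain ⟨j, hj⟩ := hk; exact ⟨j, if_pos hj⟩)
        simpa only [hy, hy'] using this
      · push Not at hk
        have hxs' : ∀ j k, x j = Sum.inr k → k ∈ s := fun j k hjk =>
          (Finset.mem_insert.1 (hxs j k hjk)).resolve_left fun h => hk j (h ▸ hjk)
        rw [← hb n i x hx hxA hxs' hnew]
        have : ∀ j, Sum.elim id (Function.update b k₀ m) (x j) = Sum.elim id b (x j) := by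
          intro j
          rcases hxj : x j with a | k
          · rfl
          · exact hupd k (hxs' j k hxj)
        simp only [this]

end Generic

section Generic

open FirstOrder.Language

variable {M : Type} [partLang.Structure M] [IsGenericPart M]

/-- A normal subgroup of the automorphism group of a generic structure that contains the pointwise
stabiliser of a finite set `s` is everything. Given an automorphism `g`, take a copy `b` of `s`
such that all tuples that mix `b` with `s ∪ g s` have colour `0`. Then the automorphism `g` on `s`
and the identity on `b` extend to one automorphism `u`, which lies in the stabiliser of `b`, a
conjugate of that of `s`, and agrees with `g` on `s`. -/
theorem mem_of_stabilizer_le [Countable M] (N : Subgroup (Equiv.Perm M))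
    (hconj : ∀ g k : Equiv.Perm M, g ∈ N → Induces k 1 → k * g * k⁻¹ ∈ N) (s : Finset M)
    (hs : ∀ g : Equiv.Perm M, Induces g 1 → (∀ a ∈ s, g a = a) → g ∈ N)
    (g : Equiv.Perm M) (hg : Induces g 1) : g ∈ N := by
  classical
  obtain ⟨b, hinj, hbA, hb⟩ := exists_points (I := M) (s ∪ s.image g)
    (fun n x => if ∀ j, (x j).isRight then color (fun j => Sum.elim id id (x j)) else 0) s
  -- `b` is a copy of `s`
  obtain ⟨k, hk, hkb⟩ := exists_perm_extending 1 s b (fun n i x hx => by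
    have hinjx : Function.Injective (fun j => b (x j)) ↔ Function.Injective x :=
      forall₂_congr fun j l => imp_congr
        ⟨fun h => hinj (hx j) (hx l) h, fun h => congrArg b h⟩ Iff.rfl
    by_cases hxi : Function.Injective x
    · have hn : 0 < n := by have := i.2; omega
      have := hb n i (fun j => Sum.inr (x j)) (fun j l h => hxi (Sum.inr_injective h))
        (by simp) (fun j k h => by rw [← Sum.inr_injective h]; exact hx j) ⟨⟨0, hn⟩, _, rfl⟩
      simp only [Sum.elim_inr, Sum.isRight_inr, implies_true, if_true, id] at this
      rw [Nat.mod_eq_of_lt (color_lt hn _)] at this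
      rw [Pi.one_apply, Equiv.Perm.one_apply, this, rel_iff_color, and_iff_right hxi]
    · exact iff_of_false (fun h => hxi (hinjx.1 (IsGenericPart.injective_of_rel h)))
        (fun h => hxi (IsGenericPart.injective_of_rel h)))
  -- `g` on `s` together with the identity on `b` is a partial automorphism
  obtain ⟨u, hu, hus⟩ := exists_perm_extending 1 (s ∪ s.image b)
    (fun a => if a ∈ s then g a else a) (fun n i x hx => by
    let y : Fin n → M ⊕ M := fun j =>
      if h : x j ∈ s then Sum.inl (x j) else
        if h' : ∃ a ∈ s, b a = x j then Sum.inr h'.choose else Sum.inl (x j)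
    have hy : ∀ j, (x j ∈ s ∧ y j = Sum.inl (x j)) ∨
        (∃ a ∈ s, x j ∉ s ∧ x j = b a ∧ y j = Sum.inr a) := by
      intro j
      by_cases h : x j ∈ s
      · exact Or.inl ⟨h, dif_pos h⟩
      · have h' : ∃ a ∈ s, b a = x j := by
          simpa using (Finset.mem_union.1 (hx j)).resolve_left h
        exact Or.inr ⟨h'.choose, h'.choose_spec.1, h, h'.choose_spec.2.symm,
          (dif_neg h).trans (dif_pos h')⟩
    let y' : Fin n → M ⊕ M := fun j => Sum.map g id (y j)
    have hxy : ∀ j, Sum.elim id b (y j) = x j := by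
      intro j
      rcases hy j with ⟨_, h2⟩ | ⟨a, _, _, h1, h2⟩
      · rw [h2]; rfl
      · rw [h2, h1]; rfl
    have hxy' : ∀ j, Sum.elim id b (y' j) = if x j ∈ s then g (x j) else x j := by
      intro j
      rcases hy j with ⟨h1, h2⟩ | ⟨a, _, h0, h1, h2⟩
      · simp only [y', h2, if_pos h1]; rfl
      · rw [if_neg h0]
        simp only [y', h2, h1]; rfl
    rw [Pi.one_apply, Equiv.Perm.one_apply]
    have hinjy : Function.Injective (fun j => if x j ∈ s then g (x j) else x j) ↔
        Function.Injective x := by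
      refine forall₂_congr fun j l => imp_congr ?_ Iff.rfl
      simp only [← hxy']
      rcases hy j with ⟨h1, h2⟩ | ⟨a, h1, h0, h1', h2⟩ <;>
        rcases hy l with ⟨h3, h4⟩ | ⟨a', h3, h0', h3', h4⟩ <;> simp only [y', h2, h4] <;>
        simp only [Sum.map_inl, Sum.map_inr, Sum.elim_inl, Sum.elim_inr, id]
      · exact g.apply_eq_iff_eq
      · refine iff_of_false (fun h => hbA a' h3 ?_) (fun h => h0' (h ▸ h1))
        rw [← h]
        exact Finset.mem_union_right _ (Finset.mem_image_of_mem g h1)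
      · refine iff_of_false (fun h => hbA a h1 ?_) (fun h => h0 (h ▸ h3))
        rw [h]
        exact Finset.mem_union_right _ (Finset.mem_image_of_mem g h3)
      · rw [h1', h3']
    by_cases hxi : Function.Injective x
    swap
    · exact iff_of_false (fun h => hxi (hinjy.1 (IsGenericPart.injective_of_rel h)))
        (fun h => hxi (IsGenericPart.injective_of_rel h))
    by_cases hall : ∀ j, x j ∈ s
    · simp only [hall, if_true]
      exact hg n i x
    push Not at hall
    obtain ⟨j₀, hj₀⟩ := hall
    have hr : ∃ a, y j₀ = Sum.inr a := by
      rcases hy j₀ with ⟨h1, _⟩ | ⟨a, _, _, _, h2⟩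
      · exact absurd h1 hj₀
      · exact ⟨a, h2⟩
    obtain ⟨a₀, ha₀⟩ := hr
    have hyi : Function.Injective y := fun j l h => hxi (by rw [← hxy, ← hxy, h])
    have hyi' : Function.Injective y' :=
      (Sum.map_injective.2 ⟨g.injective, fun _ _ h => h⟩).comp hyi
    have e1 := hb n i y hyi (fun j a ha => by
        rcases hy j with ⟨h1, h2⟩ | ⟨a', h1, _, _, h2⟩
        · obtain rfl : x j = a := by simpa [h2] using ha
          exact Finset.mem_union_left _ h1
        · simp [h2] at ha)
      (fun j k hjk => by
        rcases hy j with ⟨h1, h2⟩ | ⟨a', h1, _, _, h2⟩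
        · simp [h2] at hjk
        · obtain rfl : a' = k := by simpa [h2] using hjk
          exact h1) ⟨j₀, a₀, ha₀⟩
    have e2 := hb n i y' hyi' (fun j a ha => by
        rcases hy j with ⟨h1, h2⟩ | ⟨a', h1, _, _, h2⟩
        · obtain rfl : g (x j) = a := by simpa [y', h2] using ha
          exact Finset.mem_union_right _ (Finset.mem_image_of_mem g h1)
        · simp [y', h2] at ha)
      (fun j k hjk => by
        rcases hy j with ⟨h1, h2⟩ | ⟨a', h1, _, _, h2⟩
        · simp [y', h2] at hjk
        · obtain rfl : a' = k := by simpa [y', h2] using hjk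
          exact h1) ⟨j₀, a₀, by simp [y', ha₀]⟩
    simp only [hxy] at e1
    simp only [hxy'] at e2
    rw [e1, e2]
    have hright : ∀ j, (y' j).isRight = (y j).isRight := fun j => by simp [y']
    simp only [hright]
    by_cases hR : ∀ j, (y j).isRight
    · have : y' = y := by
        funext j
        obtain ⟨a, ha⟩ := Sum.isRight_iff.1 (hR j)
        simp [y', ha]
      rw [this]
    · rw [if_neg hR, if_neg hR])
  have hkuk : k⁻¹ * u * k ∈ N := by
    refine hs _ ?_ fun a ha => ?_
    · simpa using (hk.inv.mul hu).mul hk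
    · have hba : u (b a) = b a := by
        rw [hus _ (Finset.mem_union_right _ (Finset.mem_image_of_mem b ha)), if_neg]
        exact fun h => hbA a ha (Finset.mem_union_left _ h)
      rw [Equiv.Perm.mul_apply, Equiv.Perm.mul_apply, hkb a ha, hba, ← hkb a ha]
      exact k.symm_apply_apply a
  have huN : u ∈ N := by
    have := hconj _ k hkuk hk
    simpa [mul_assoc] using this
  have hgu : u⁻¹ * g ∈ N := by
    refine hs _ ?_ fun a ha => ?_
    · simpa using hu.inv.mul hg
    · rw [Equiv.Perm.mul_apply, Equiv.Perm.inv_eq_iff_eq,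
        hus a (Finset.mem_union_left _ ha), if_pos ha]
  simpa using N.mul_mem huN hgu

/-- A countable generic structure is the Fraïssé limit of the class of finite partitioned
structures. -/
theorem isFraisseLimit_of_isGenericPart [Countable M] : IsFraisseLimit partClass M where
  ultrahomogeneous := by
    classical
    intro S hS f
    have hfin : (S : Set M).Finite := by
      have := (Substructure.fg_iff_structure_fg S).1 hS
      have := Structure.FG.finite (L := partLang) (M := S) this
      exact Set.toFinite _
    obtain ⟨g, hg, hgf⟩ := exists_perm_extending 1 hfin.toFinset
      (fun a => if h : a ∈ S then f ⟨a, h⟩ else a) (fun n i x hx => by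
        have hx' : ∀ j, x j ∈ S := fun j => by simpa using hx j
        have := f.map_rel (partRel i) (fun j => ⟨x j, hx' j⟩)
        simp only [hx', dif_pos]
        exact this)
    refine ⟨⟨g, fun F => isEmptyElim F, fun {n} i x => hg n i x⟩, ?_⟩
    ext ⟨a, ha⟩
    have := hgf a (by simpa using ha)
    rw [dif_pos ha] at this
    exact this.symm
  age := by
    classical
    ext N
    constructor
    · rintro ⟨hN, ⟨f⟩⟩
      refine ⟨hN.finite, fun n i x hx => ?_, fun n hn x hx => ?_⟩
      · have := IsGenericPart.injective_of_rel ((f.map_rel (partRel i) x).2 hx)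
        exact Function.Injective.of_comp this
      · have := IsGenericPart.existsUnique_rel hn (f.injective.comp hx)
        simpa only [f.map_rel (partRel _) x] using this
    · rintro ⟨hN, hinj, huniq⟩
      refine ⟨Structure.fg_iff_finite.2 hN, ?_⟩
      have := Fintype.ofFinite N
      obtain ⟨b, hb, -, hrel⟩ := exists_points (M := M) (I := N) ∅
        (fun n x => if h : ∃ y : Fin n → N, (∀ j, x j = Sum.inr (y j)) ∧
          ∃ i : Fin n, Structure.RelMap (partRel i) y then h.choose_spec.2.choose else 0)
        Finset.univ
      have hb' : Function.Injective b := fun k l h => hb (by simp) (by simp) h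
      refine ⟨⟨⟨b, hb'⟩, fun F => isEmptyElim F, fun {n} (i : Fin n) y => ?_⟩⟩
      by_cases hy : Function.Injective y
      swap
      · exact iff_of_false (fun h => hy (Function.Injective.of_comp (f := b)
          (IsGenericPart.injective_of_rel (i := i) h))) (fun h => hy (hinj n i y h))
      have hn : 0 < n := by have := i.2; omega
      have := hrel n i (fun j => Sum.inr (y j)) (fun j l h => hy (Sum.inr_injective h))
        (by simp) (by simp) ⟨⟨0, hn⟩, _, rfl⟩
      have hex : ∃ y' : Fin n → N, (∀ j, (Sum.inr (y j) : M ⊕ N) = Sum.inr (y' j)) ∧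
          ∃ i : Fin n, Structure.RelMap (partRel i) y' :=
        ⟨y, fun _ => rfl, (huniq n hn y hy).exists⟩
      rw [dif_pos hex, Nat.mod_eq_of_lt (Fin.is_lt _)] at this
      refine this.trans ?_
      have hyy : hex.choose = y := funext fun j => (Sum.inr_injective (hex.choose_spec.1 j)).symm
      have hcast : ∀ {i' : Fin n} {y' : Fin n → N}, y' = y →
          Structure.RelMap (partRel i') y' → Structure.RelMap (partRel i') y := by
        rintro i' _ rfl h
        exact h
      have hc := hcast hyy hex.choose_spec.2.choose_spec
      rw [← Fin.ext_iff]
      constructor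
      · intro h
        rw [← h] at hc
        exact hc
      · intro h
        exact (huniq n hn y hy).unique h hc

end Generic

/-! ### A generic structure on the natural numbers -/

/-- There is a sequence in which every element of a countable type occurs arbitrarily late. -/
theorem exists_seq_frequently_eq (α : Type*) [Countable α] [Nonempty α] :
    ∃ t : ℕ → α, ∀ a N, ∃ m, N ≤ m ∧ t m = a := by
  obtain ⟨f, hf⟩ := exists_surjective_nat α
  refine ⟨fun m => f (Nat.unpair m).1, fun a N => ?_⟩
  obtain ⟨k, rfl⟩ := hf a
  exact ⟨Nat.pair k N, Nat.right_le_pair k N, by simp⟩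

/-- There is a generic structure on `ℕ`: the colour of a tuple with largest entry `m` is read off
from the `m`-th member of a sequence in which every finitely supported colouring of lists occurs
arbitrarily late. -/
theorem exists_isGenericPart : ∃ _ : partLang.Structure ℕ, IsGenericPart ℕ := by
  classical
  obtain ⟨t, ht⟩ := exists_seq_frequently_eq (List (Option ℕ) →₀ ℕ)
  let code : ∀ {n : ℕ}, (Fin n → ℕ) → List (Option ℕ) := fun {n} x =>
    List.ofFn fun j => if x j = Finset.univ.sup x then none else some (x j)
  let col : ∀ {n : ℕ}, (Fin n → ℕ) → ℕ := fun {n} x => t (Finset.univ.sup x) (code x)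
  let S : partLang.Structure ℕ :=
    { funMap := fun f => isEmptyElim f
      RelMap := fun {n} (i : Fin n) x => Function.Injective x ∧ (i : ℕ) = col x % n }
  have hS : ∀ {n : ℕ} {i : Fin n} {x : Fin n → ℕ},
      FirstOrder.Language.Structure.RelMap (partRel i) x ↔ Function.Injective x ∧ (i : ℕ) = col x % n :=
    Iff.rfl
  refine ⟨S, ⟨fun h => (hS.1 h).1, fun {n} hn x hx => ?_, fun A c => ?_⟩⟩
  · refine ⟨⟨col x % n, Nat.mod_lt _ hn⟩, hS.2 ⟨hx, rfl⟩, fun i hi => Fin.ext (hS.1 hi).2⟩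
  · -- the injective tuples of elements of `A` and the new point form a finite set
    let B : Finset (Option ℕ) := insert none (A.image some)
    have hfin : {l : List (Option ℕ) | l.Nodup ∧ ∀ o ∈ l, o ∈ B}.Finite := by
      refine ((List.finite_length_le B B.card).image (List.map Subtype.val)).subset ?_
      rintro l ⟨hl, hlB⟩
      lift l to List B using hlB
      refine ⟨l, ?_, rfl⟩
      simpa using (List.Nodup.of_map _ hl).length_le_card
    let c' : List (Option ℕ) →₀ ℕ := Finsupp.onFinset hfin.toFinset
      (fun l => if l ∈ hfin.toFinset then c l.length l.get else 0) (fun l hl => by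
        by_contra h
        exact hl (if_neg h))
    obtain ⟨m, hm, hmc⟩ := ht c' (A.sup id + 1)
    have hAm : ∀ a ∈ A, a < m := fun a ha =>
      (Nat.lt_succ_of_le (Finset.le_sup (f := id) ha)).trans_le hm
    refine ⟨m, fun h => lt_irrefl _ (hAm m h), fun n i x hx hxA ⟨j₀, hj₀⟩ => ?_⟩
    have hsup : Finset.univ.sup (fun j => (x j).getD m) = m := by
      refine le_antisymm (Finset.sup_le fun j _ => ?_) ?_
      · rcases hj : x j with _ | a
        · exact le_rfl
        · exact (hAm a (hxA j a hj)).le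
      · refine le_trans ?_ (Finset.le_sup (Finset.mem_univ j₀))
        rw [hj₀]; rfl
    have hne : ∀ j a, x j = some a → a ≠ m := fun j a hj => (hAm a (hxA j a hj)).ne
    have hcode : code (fun j => (x j).getD m) = List.ofFn x := by
      simp only [code, hsup]
      congr 1
      funext j
      rcases hj : x j with _ | a
      · exact if_pos rfl
      · exact if_neg (hne j a hj)
    have hinj : Function.Injective fun j => (x j).getD m := by
      intro j l hjl
      apply hx
      rcases hj : x j with _ | a <;> rcases hl : x l with _ | a'
      · rfl
      · simp only [hj, hl, Option.getD_none, Option.getD_some] at hjl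
        exact absurd hjl.symm (hne l a' hl)
      · simp only [hj, hl, Option.getD_none, Option.getD_some] at hjl
        exact absurd hjl (hne j a hj)
      · simp only [hj, hl, Option.getD_some] at hjl
        rw [hjl]
    have hmem : List.ofFn x ∈ hfin.toFinset := by
      rw [Set.Finite.mem_toFinset]
      refine ⟨List.nodup_ofFn.2 hx, fun o ho => ?_⟩
      obtain ⟨j, rfl⟩ := (List.mem_ofFn' _ _).1 ho
      rcases hj : x j with _ | a
      · simp [B]
      · simp [B, hxA j a hj]
    have hget : ∀ (l : List (Option ℕ)) (k : ℕ) (y : Fin k → Option ℕ), l = List.ofFn y →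
        c l.length l.get = c k y := by
      rintro l k y rfl
      have hlen : (List.ofFn y).length = k := List.length_ofFn
      have : ∀ (k' : ℕ) (h : k' = k) (y' : Fin k' → Option ℕ), (∀ j, y' j = y (j.cast h)) →
          c k' y' = c k y := by
        rintro _ rfl y' hy'
        rw [show y' = y from funext hy']
      exact this _ hlen _ fun j => by simp; rfl
    rw [hS, and_iff_right hinj]
    have : col (fun j => (x j).getD m) = c n x := by
      simp only [col, hsup, hcode, hmc]
      rw [Finsupp.onFinset_apply, if_pos hmem, hget _ n x rfl]
    rw [this]

/-! ### Covers of a generic structure by a compact group -/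

section Induces

open FirstOrder.Language

variable {M : Type} [partLang.Structure M]

/-- The transformation `f` of `M` maps the relations as `σ` does, and reflects them. -/
def InducesMap (f : M → M) (σ : ∀ n : ℕ, Equiv.Perm (Fin n)) : Prop :=
  ∀ (n : ℕ) (i : Fin n) (x : Fin n → M),
    Structure.RelMap (partRel (σ n i)) (fun j => f (x j)) ↔ Structure.RelMap (partRel i) x

theorem InducesMap.comp {f f' : M → M} {σ τ : ∀ n : ℕ, Equiv.Perm (Fin n)}
    (hf : InducesMap f σ) (hf' : InducesMap f' τ) : InducesMap (f ∘ f') (σ * τ) :=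
  fun n i x => (hf n (τ n i) (fun j => f' (x j))).trans (hf' n i x)

variable [IsGenericPart M]

theorem exists_rel {n : ℕ} (i : Fin n) : ∃ x : Fin n → M, Structure.RelMap (partRel i) x := by
  obtain ⟨b, -, -, hb⟩ := exists_points (M := M) (I := Fin n) ∅ (fun _ _ => i) Finset.univ
  refine ⟨b, ?_⟩
  have hn : 0 < n := by have := i.2; omega
  have := hb n i (fun j => Sum.inr j) Sum.inr_injective (by simp) (by simp) ⟨⟨0, hn⟩, _, rfl⟩
  exact this.2 (Nat.mod_eq_of_lt i.2).symm

/-- A transformation determines the permutations of the relations that it induces. -/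
theorem InducesMap.unique {f : M → M} {σ τ : ∀ n : ℕ, Equiv.Perm (Fin n)}
    (hσ : InducesMap f σ) (hτ : InducesMap f τ) : σ = τ := by
  funext n
  ext i
  obtain ⟨x, hx⟩ := exists_rel (M := M) i
  rw [(rel_iff_color.1 ((hσ n i x).2 hx)).2, (rel_iff_color.1 ((hτ n i x).2 hx)).2]

end Induces

/-- The topology of pointwise convergence on a finite symmetric group is discrete. -/
instance discreteTopology_perm {X : Type*} [Finite X] : DiscreteTopology (Equiv.Perm X) := by
  have := Fintype.ofFinite X
  refine discreteTopology_iff_isOpen_singleton.2 fun σ => ?_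
  refine isOpen_induced_iff.2 ⟨_, isOpen_setOf_agree σ Finset.univ, ?_⟩
  ext τ
  simp only [Set.mem_preimage, Set.mem_ofPred_eq, Set.mem_singleton_iff, Equiv.ext_iff]
  exact ⟨fun h x => h x (Finset.mem_univ x), fun h x _ => h x⟩

section Cover

open FirstOrder.Language Filter Topology

variable {M : Type} [partLang.Structure M] {H : Type} [Group H] {Q : Type}
  (ρ : H →* ∀ n : ℕ, Equiv.Perm (Fin n)) (κ : H →* Equiv.Perm Q)

/-- The pairs of a transformation `f` of `M` and an element `h` of `H` such that `f` maps the
relations as `ρ h` does. -/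
def fiberMonoid (M : Type) [partLang.Structure M] : Submonoid (Function.End M × H) where
  carrier := {p | InducesMap p.1 (ρ p.2)}
  one_mem' := by
    change InducesMap id (ρ 1)
    rw [map_one]
    exact fun _ _ _ => Iff.rfl
  mul_mem' := by
    intro p q hp hq
    change InducesMap (p.1 ∘ q.1) (ρ (p.2 * q.2))
    rw [map_mul]
    exact hp.comp hq

/-- The action of `fiberMonoid` on the disjoint union of `M` and `Q`, where `H` acts on `Q`. -/
def coverHom : fiberMonoid ρ M →* Function.End (M ⊕ Q) where
  toFun p := Sum.map p.1.1 (κ p.1.2)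
  map_one' := by
    funext x
    rcases x with x | x
    · rfl
    · change Sum.inr (κ 1 x) = _
      rw [map_one]
      rfl
  map_mul' p q := by
    funext x
    rcases x with x | x
    · rfl
    · change Sum.inr (κ (p.1.2 * q.1.2) x) = _
      rw [map_mul]
      rfl

/-- The group of all permutations of the disjoint union of `M` and `Q` given by a permutation `g` of
`M` and an element `h` of `H` such that `g` induces `ρ h`. -/
def coverGroup (M : Type) [partLang.Structure M] : Subgroup (Equiv.Perm (M ⊕ Q)) where
  carrier := {p | ∃ (g : Equiv.Perm M) (h : H), Induces g (ρ h) ∧ p = Equiv.sumCongr g (κ h)}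
  one_mem' := by
    refine ⟨1, 1, ?_, ?_⟩
    · rw [map_one]
      exact Induces.one
    · ext (x | x) <;> simp
  mul_mem' := by
    rintro p q ⟨g, h, hg, rfl⟩ ⟨g', h', hg', rfl⟩
    refine ⟨g * g', h * h', ?_, ?_⟩
    · rw [map_mul]
      exact hg.mul hg'
    · ext (x | x) <;> simp
  inv_mem' := by
    rintro p ⟨g, h, hg, rfl⟩
    refine ⟨g⁻¹, h⁻¹, ?_, ?_⟩
    · rw [map_inv]
      exact hg.inv
    · rw [inv_eq_iff_mul_eq_one]
      ext (x | x) <;> simp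

theorem mem_mrange_coverHom {f : Function.End (M ⊕ Q)} :
    f ∈ MonoidHom.mrange (coverHom (M := M) ρ κ) ↔
      ∃ (f₀ : M → M) (h : H), InducesMap f₀ (ρ h) ∧ f = Sum.map f₀ (κ h) := by
  constructor
  · rintro ⟨⟨⟨f₀, h⟩, hf⟩, rfl⟩
    exact ⟨f₀, h, hf, rfl⟩
  · rintro ⟨f₀, h, hf, rfl⟩
    exact ⟨⟨⟨f₀, h⟩, hf⟩, rfl⟩

theorem permToEnd_mem_mrange_coverHom {p : Equiv.Perm (M ⊕ Q)} :
    permToEnd p ∈ MonoidHom.mrange (coverHom (M := M) ρ κ) ↔ p ∈ coverGroup ρ κ M := by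
  rw [mem_mrange_coverHom]
  constructor
  · rintro ⟨f₀, h, hf, hp⟩
    have hp' : ∀ x, p x = Sum.map f₀ (κ h) x := congrFun hp
    have hinj : Function.Injective f₀ := fun a b hab =>
      Sum.inl_injective (p.injective (by rw [hp', hp', Sum.map_inl, Sum.map_inl, hab]))
    have hsurj : Function.Surjective f₀ := fun b => by
      obtain ⟨a | a, ha⟩ := p.surjective (Sum.inl b) <;> rw [hp'] at ha
      · exact ⟨a, Sum.inl_injective ha⟩
      · simp at ha
    exact ⟨Equiv.ofBijective f₀ ⟨hinj, hsurj⟩, h, hf, Equiv.ext fun x => hp' x⟩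
  · rintro ⟨g, h, hg, rfl⟩
    exact ⟨g, h, hg, rfl⟩

theorem coverHom_injective [IsGenericPart M]
    (hker : ∀ h, ρ h = 1 → κ h = 1 → h = 1) : Function.Injective (coverHom (M := M) ρ κ) := by
  rintro ⟨⟨f, h⟩, hf⟩ ⟨⟨f', h'⟩, hf'⟩ hff
  have hfun : ∀ x, Sum.map f (κ h) x = Sum.map f' (κ h') x := congrFun hff
  obtain rfl : f = f' := funext fun a => Sum.inl_injective (hfun (Sum.inl a))
  have hκ : κ h = κ h' := Equiv.ext fun q => Sum.inr_injective (hfun (Sum.inr q))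
  have hρ : ρ h = ρ h' := InducesMap.unique hf hf'
  have : h * h'⁻¹ = 1 := hker _ (by rw [map_mul, map_inv, hρ, mul_inv_cancel])
    (by rw [map_mul, map_inv, hκ, mul_inv_cancel])
  obtain rfl : h = h' := mul_inv_eq_one.1 this
  rfl

variable {ρ κ}

theorem isOpen_setOf_eq [TopologicalSpace H] [IsTopologicalGroup H]
    (hκ : IsOpen (κ.ker : Set H)) (h : H) : IsOpen {d | κ d = κ h} := by
  have : {d | κ d = κ h} = (fun d => h⁻¹ * d) ⁻¹' (κ.ker : Set H) := by
    ext d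
    change κ d = κ h ↔ κ (h⁻¹ * d) = 1
    rw [map_mul, map_inv, inv_mul_eq_one, eq_comm]
  rw [this]
  exact hκ.preimage (continuous_const_mul _)

theorem isOpen_setOf_apply_eq [TopologicalSpace H] (hρ : Continuous ρ) (n : ℕ) (h : H) :
    IsOpen {d | ρ d n = ρ h n} :=
  (isOpen_discrete {ρ h n}).preimage ((continuous_apply n).comp hρ)

/-- If `f` permutes the relations as `σ` does and `τ` agrees with `σ` in arities up to the size of
`s`, then the restriction of `f` to `s` extends to a permutation inducing `τ`: injective tuples of
elements of `s` are no longer than the size of `s`. -/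
theorem InducesMap.exists_perm [IsGenericPart M] [Countable M] {f : M → M}
    {σ τ : ∀ n : ℕ, Equiv.Perm (Fin n)} (hf : InducesMap f σ) (s : Finset M)
    (hτ : ∀ n ≤ s.card, τ n = σ n) : ∃ g : Equiv.Perm M, Induces g τ ∧ ∀ a ∈ s, g a = f a := by
  refine exists_perm_extending τ s f fun n i x hx => ?_
  by_cases hn : n ≤ s.card
  · rw [hτ n hn]
    exact hf n i x
  · have hni : ¬ Function.Injective x := fun hi => hn <| by
      simpa using Finset.card_le_card_of_injOn x (s := Finset.univ) (fun j _ => hx j) hi.injOn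
    exact iff_of_false (fun h => hni (Function.Injective.of_comp (f := f)
      (IsGenericPart.injective_of_rel h))) (fun h => hni (IsGenericPart.injective_of_rel h))

/-- The closure, in the space of all transformations, of the part of the cover that lies over a
dense subset of `H`. Second components along an ultrafilter converge by compactness; conversely, an
element of `H` is approximated by one of the dense subset, and the given transformation is extended
from a finite set to a permutation inducing the approximation. -/
theorem closure_cover [IsGenericPart M] [Countable M] [TopologicalSpace H] [IsTopologicalGroup H]
    [CompactSpace H] (hρ : Continuous ρ) (hκ : IsOpen (κ.ker : Set H)) {D : Set H} (hD : Dense D) :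
    closure (permToEnd '' {p | ∃ (g : Equiv.Perm M) (h : H), h ∈ D ∧ Induces g (ρ h) ∧
      p = Equiv.sumCongr g (κ h)}) = (MonoidHom.mrange (coverHom (M := M) ρ κ) : Set _) := by
  classical
  ext f
  rw [SetLike.mem_coe, mem_mrange_coverHom]
  constructor
  · intro hf
    obtain ⟨u, hu, huf⟩ := mem_closure_iff_ultrafilter.1 hf
    -- the second components along an ultrafilter converging to `f` converge to some `h`
    have hex : ∀ t : Function.End (M ⊕ Q), ∃ d : H, t ∈ permToEnd '' {p | ∃ (g : Equiv.Perm M)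
        (h : H), h ∈ D ∧ Induces g (ρ h) ∧ p = Equiv.sumCongr g (κ h)} →
        ∃ g : Equiv.Perm M, Induces g (ρ d) ∧ t = Sum.map g (κ d) := by
      intro t
      by_cases ht : t ∈ permToEnd '' {p | ∃ (g : Equiv.Perm M)
        (h : H), h ∈ D ∧ Induces g (ρ h) ∧ p = Equiv.sumCongr g (κ h)}
      · obtain ⟨_, ⟨g, h, -, hg, rfl⟩, rfl⟩ := ht
        exact ⟨h, fun _ => ⟨g, hg, rfl⟩⟩
      · exact ⟨1, fun h => absurd h ht⟩
    choose k hk using hex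
    obtain ⟨h, -, hh⟩ := isCompact_univ.ultrafilter_le_nhds (u.map k) (by simp)
    have key : ∀ (s : Finset (M ⊕ Q)) (n : ℕ), ∃ (g : Equiv.Perm M) (d : H), Induces g (ρ d) ∧
        κ d = κ h ∧ ρ d n = ρ h n ∧ ∀ x ∈ s, Sum.map g (κ d) x = f x := by
      intro s n
      have h1 : ∀ᶠ t in (u : Filter (Function.End (M ⊕ Q))), κ (k t) = κ h :=
        hh ((isOpen_setOf_eq hκ h).mem_nhds rfl)
      have h2 : ∀ᶠ t in (u : Filter (Function.End (M ⊕ Q))), ρ (k t) n = ρ h n :=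
        hh ((isOpen_setOf_apply_eq hρ n h).mem_nhds rfl)
      have h3 : ∀ᶠ t in (u : Filter (Function.End (M ⊕ Q))), ∀ x ∈ s, t x = f x :=
        huf ((isOpen_setOf_agree f s).mem_nhds fun _ _ => rfl)
      obtain ⟨t, ⟨⟨ht1, ht2⟩, ht3⟩, ht⟩ := (((h1.and h2).and h3).and hu).exists
      obtain ⟨g, hg, hgt⟩ := hk t ht
      exact ⟨g, k t, hg, ht1, ht2, fun x hx => (congrFun hgt x).symm.trans (ht3 x hx)⟩
    have hl : ∀ m, ∃ m', f (Sum.inl m) = Sum.inl m' := fun m => by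
      obtain ⟨g, d, -, -, -, hg⟩ := key {Sum.inl m} 0
      exact ⟨g m, (hg _ (by simp)).symm⟩
    choose f₀ hf₀ using hl
    refine ⟨f₀, h, fun n i x => ?_, funext fun x => ?_⟩
    · obtain ⟨g, d, hg, -, hd, hgx⟩ := key (Finset.univ.image fun j => Sum.inl (x j)) n
      rw [← hg n i x, hd]
      have : ∀ j, f₀ (x j) = g (x j) := fun j => Sum.inl_injective (by
        rw [← hf₀, ← hgx (Sum.inl (x j)) (by simp), Sum.map_inl])
      simp only [this]
    · rcases x with m | q
      · exact hf₀ m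
      · obtain ⟨g, d, -, hd, -, hg⟩ := key {Sum.inr q} 0
        rw [← hg _ (by simp), Sum.map_inr, Sum.map_inr, hd]
  · rintro ⟨f₀, h, hf, rfl⟩
    refine mem_closure_pointwise_iff.2 fun s => ?_
    have hU : IsOpen ({d | κ d = κ h} ∩ ⋂ n ∈ Set.Iic s.toLeft.card, {d | ρ d n = ρ h n}) :=
      (isOpen_setOf_eq hκ h).inter
        ((Set.finite_Iic _).isOpen_biInter fun n _ => isOpen_setOf_apply_eq hρ n h)
    obtain ⟨d, ⟨hd1, hd2⟩, hdD⟩ := hD.inter_open_nonempty _ hU ⟨h, rfl, by simp⟩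
    simp only [Set.mem_iInter] at hd2
    obtain ⟨g, hg, hgs⟩ := hf.exists_perm s.toLeft (τ := ρ d) fun n hn => hd2 n hn
    refine ⟨_, ⟨_, ⟨g, d, hdD, hg, rfl⟩, rfl⟩, ?_⟩
    rintro (m | q) hx
    · exact congrArg Sum.inl (hgs m (by simpa using hx))
    · change Sum.inr (κ d q) = Sum.inr (κ h q)
      rw [show κ d = κ h from hd1]

theorem closure_perm_cover [IsGenericPart M] [Countable M] [TopologicalSpace H]
    [IsTopologicalGroup H] [CompactSpace H] (hρ : Continuous ρ) (hκ : IsOpen (κ.ker : Set H))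
    {D : Set H} (hD : Dense D) :
    closure {p | ∃ (g : Equiv.Perm M) (h : H), h ∈ D ∧ Induces g (ρ h) ∧
      p = Equiv.sumCongr g (κ h)} = (coverGroup ρ κ M : Set (Equiv.Perm (M ⊕ Q))) := by
  ext p
  rw [mem_closure_perm_iff, closure_cover hρ hκ hD, SetLike.mem_coe, SetLike.mem_coe,
    permToEnd_mem_mrange_coverHom]

theorem transClosure_coverGroup [IsGenericPart M] [Countable M] [TopologicalSpace H]
    [IsTopologicalGroup H] [CompactSpace H] (hρ : Continuous ρ) (hκ : IsOpen (κ.ker : Set H)) :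
    transClosure (coverGroup ρ κ M) = (MonoidHom.mrange (coverHom (M := M) ρ κ) : Set _) := by
  rw [← closure_cover hρ hκ dense_univ, transClosure]
  simp only [Set.mem_univ, true_and]
  rfl

theorem isClosed_coverGroup [IsGenericPart M] [Countable M] [TopologicalSpace H]
    [IsTopologicalGroup H] [CompactSpace H] (hρ : Continuous ρ) (hκ : IsOpen (κ.ker : Set H)) :
    IsClosed (coverGroup ρ κ M : Set (Equiv.Perm (M ⊕ Q))) := by
  rw [← closure_perm_cover hρ hκ dense_univ]
  exact isClosed_closure

end Cover

/-! ### Oligomorphicity -/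

theorem isOligomorphic_of_invariant {X : Type*} {Θ : Subgroup (Equiv.Perm X)}
    (h : ∀ k : ℕ, ∃ (I : Type) (_ : Finite I) (F : (Fin k → X) → I),
      ∀ x y, F x = F y → ∃ g ∈ Θ, ∀ i, g (y i) = x i) : IsOligomorphic Θ := by
  intro k
  obtain ⟨I, hI, F, hF⟩ := h k
  refine Finite.of_injective (fun q : MulAction.orbitRel.Quotient Θ (Fin k → X) =>
    F (Quotient.out q)) fun q r hqr => ?_
  obtain ⟨g, hg, hgi⟩ := hF _ _ hqr
  rw [← Quotient.out_eq q, ← Quotient.out_eq r]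
  exact Quotient.sound ⟨⟨g, hg⟩, funext hgi⟩

/-- A tuple of elements of `M ⊕ Q` is determined up to automorphisms of `M` by its components in
`Q`, its equality pattern, and the relations between its components in `M`. -/
theorem isOligomorphic_coverGroup {M : Type} [partLang.Structure M] [IsGenericPart M] [Countable M]
    {H : Type} [Group H] {Q : Type} [Finite Q] (ρ : H →* ∀ n : ℕ, Equiv.Perm (Fin n))
    (κ : H →* Equiv.Perm Q) : IsOligomorphic (coverGroup ρ κ M) := by
  classical
  refine isOligomorphic_of_invariant fun k => ⟨(Fin k → Option Q) × (Fin k → Fin k → Prop) ×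
    (∀ n : Fin (k + 1), Fin n → (Fin n → Fin k) → Prop), inferInstance,
    fun t => (fun j => (t j).getRight?, fun j l => t j = t l, fun n i s =>
      ∃ y : Fin n → M, (∀ j, t (s j) = Sum.inl (y j)) ∧
        FirstOrder.Language.Structure.RelMap (partRel i) y), fun t' t htt => ?_⟩
  simp only [Prod.mk.injEq, funext_iff, eq_iff_iff] at htt
  obtain ⟨h1, h2, h3⟩ := htt
  have hleft : ∀ j a, t j = Sum.inl a → ∃ a', t' j = Sum.inl a' := by
    intro j a hj
    have := h1 j
    rw [hj] at this
    rcases ht' : t' j with a' | q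
    · exact ⟨a', rfl⟩
    · simp [ht'] at this
  let s : Finset M := (Finset.univ.image t).toLeft
  have hs : ∀ a ∈ s, ∃ j, t j = Sum.inl a := fun a ha => by simpa [s] using ha
  have hex : ∀ a : M, ∃ a' : M, ∀ j, t j = Sum.inl a → t' j = Sum.inl a' := by
    intro a
    by_cases ha : ∃ j, t j = Sum.inl a
    · obtain ⟨j, hj⟩ := ha
      obtain ⟨a', ha'⟩ := hleft j a hj
      exact ⟨a', fun l hl => by rw [← ha', h2, hl, hj]⟩
    · exact ⟨a, fun j hj => absurd ⟨j, hj⟩ ha⟩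
  choose f hf using hex
  obtain ⟨g, hg, hgs⟩ := exists_perm_extending 1 s f (fun n i x hx => by
    choose idx hidx using fun j => hs (x j) (hx j)
    have hidx' : ∀ j, t' (idx j) = Sum.inl (f (x j)) := fun j => hf _ _ (hidx j)
    rw [Pi.one_apply, Equiv.Perm.one_apply]
    by_cases hn : n < k + 1
    · have := h3 ⟨n, hn⟩ i idx
      constructor
      · intro h
        obtain ⟨y, hy, hyr⟩ := this.1 ⟨_, hidx', h⟩
        obtain rfl : x = y := funext fun j => Sum.inl_injective (by rw [← hy, hidx])
        exact hyr
      · intro h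
        obtain ⟨y, hy, hyr⟩ := this.2 ⟨_, hidx, h⟩
        obtain rfl : (fun j => f (x j)) = y :=
          funext fun j => Sum.inl_injective (by rw [← hy, hidx'])
        exact hyr
    · have hni : ¬ Function.Injective idx := fun hi => hn <| by
        have := Fintype.card_le_of_injective idx hi
        simp only [Fintype.card_fin] at this
        omega
      refine iff_of_false (fun h => hni fun j l hjl => ?_) (fun h => hni fun j l hjl => ?_)
      · refine IsGenericPart.injective_of_rel h (Sum.inl_injective (β := Q) ?_)
        rw [← hidx', ← hidx', hjl]
      · refine IsGenericPart.injective_of_rel h (Sum.inl_injective (β := Q) ?_)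
        rw [← hidx, ← hidx, hjl])
  refine ⟨Equiv.sumCongr g (κ 1), ⟨g, 1, by rwa [map_one], rfl⟩, fun j => ?_⟩
  rcases hj : t j with a | q
  · have ha : a ∈ s := by
      simp only [s, Finset.mem_toLeft, Finset.mem_image, Finset.mem_univ, true_and]
      exact ⟨j, hj⟩
    rw [hf a j hj, ← hgs a ha]
    rfl
  · have := h1 j
    rw [hj] at this
    rcases ht' : t' j with a' | q'
    · simp [ht'] at this
    · obtain rfl : q' = q := by simpa [ht'] using this
      simp

/-! ### Transport along a bijection of the domains -/

section Transport

variable {X Y : Type*} (e : X ≃ Y)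

/-- Conjugation of transformations with a bijection. -/
def conjEnd : Function.End X ≃* Function.End Y where
  toFun f := e ∘ f ∘ e.symm
  invFun f := e.symm ∘ f ∘ e
  left_inv f := by
    funext x
    change e.symm (e (f (e.symm (e x)))) = f x
    simp
  right_inv f := by
    funext x
    change e (e.symm (f (e (e.symm x)))) = f x
    simp
  map_mul' f g := by
    funext x
    change e (f (g _)) = e (f (e.symm (e (g _))))
    rw [e.symm_apply_apply]

theorem conjEnd_apply (f : Function.End X) (y : Y) : conjEnd e f y = e (f (e.symm y)) := rfl

theorem mem_transClosure_map {Θ : Subgroup (Equiv.Perm X)} {f : Function.End X} :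
    conjEnd e f ∈ transClosure (Θ.map e.permCongrHom.toMonoidHom) ↔ f ∈ transClosure Θ := by
  classical
  rw [mem_transClosure_iff, mem_transClosure_iff]
  constructor
  · intro h s
    obtain ⟨_, ⟨g, hg, rfl⟩, hgs⟩ := h (s.map e.toEmbedding)
    refine ⟨g, hg, fun x hx => ?_⟩
    have := hgs (e x) (by simpa using hx)
    rw [conjEnd_apply, e.symm_apply_apply] at this
    apply e.injective
    rw [← this]
    change _ = e (g (e.symm (e x)))
    rw [e.symm_apply_apply]
  · intro h s
    obtain ⟨g, hg, hgs⟩ := h (s.map e.symm.toEmbedding)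
    refine ⟨_, ⟨g, hg, rfl⟩, fun y hy => ?_⟩
    exact congrArg e (hgs (e.symm y) (by simpa using hy))

theorem continuous_permCongr : Continuous (e.permCongr : Equiv.Perm X → Equiv.Perm Y) := by
  refine continuous_induced_rng.2 ?_
  let _ : TopologicalSpace X := ⊥
  let _ : TopologicalSpace Y := ⊥
  have : DiscreteTopology X := ⟨rfl⟩
  refine continuous_pi fun y => ?_
  exact (continuous_of_discreteTopology (f := e)).comp
    ((continuous_apply (e.symm y)).comp continuous_induced_dom)

/-- Conjugation of permutations with a bijection, as a homeomorphism. -/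
def permCongrHomeo : Equiv.Perm X ≃ₜ Equiv.Perm Y where
  toEquiv := e.permCongr
  continuous_toFun := continuous_permCongr e
  continuous_invFun := continuous_permCongr e.symm

theorem closure_map_permCongr (Θ : Subgroup (Equiv.Perm X)) :
    closure (Θ.map e.permCongrHom.toMonoidHom : Set (Equiv.Perm Y)) =
      e.permCongr '' closure (Θ : Set (Equiv.Perm X)) :=
  ((permCongrHomeo e).image_closure _).symm

theorem isClosed_map_permCongr {Θ : Subgroup (Equiv.Perm X)}
    (hΘ : IsClosed (Θ : Set (Equiv.Perm X))) :
    IsClosed (Θ.map e.permCongrHom.toMonoidHom : Set (Equiv.Perm Y)) :=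
  (permCongrHomeo e).isClosedMap _ hΘ

theorem isOligomorphic_map_permCongr {Θ : Subgroup (Equiv.Perm X)} (hΘ : IsOligomorphic Θ) :
    IsOligomorphic (Θ.map e.permCongrHom.toMonoidHom) := by
  intro k
  have := hΘ k
  refine Finite.of_surjective
    (Quotient.map' (s₁ := MulAction.orbitRel Θ (Fin k → X)) (fun x j => e (x j)) ?_) ?_
  · rintro _ y ⟨g, rfl⟩
    refine ⟨⟨_, ⟨g.1, g.2, rfl⟩⟩, funext fun j => ?_⟩
    change e (g.1 (e.symm (e (y j)))) = e (g.1 (y j))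
    rw [e.symm_apply_apply]
  · rintro ⟨y⟩
    refine ⟨Quotient.mk _ fun j => e.symm (y j), ?_⟩
    exact congrArg (Quotient.mk _) (funext fun j => e.apply_symm_apply (y j))

/-- A permutation group is topologically isomorphic to its conjugate. -/
noncomputable def mapPermCongrEquiv (Θ : Subgroup (Equiv.Perm X)) :
    Θ ≃ₜ* Θ.map e.permCongrHom.toMonoidHom where
  toMulEquiv := Θ.equivMapOfInjective e.permCongrHom.toMonoidHom e.permCongrHom.injective
  continuous_toFun := by
    refine continuous_induced_rng.2 ?_
    exact (continuous_permCongr e).comp continuous_subtype_val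
  continuous_invFun := by
    refine continuous_induced_rng.2 ?_
    have : ∀ p : Θ.map e.permCongrHom.toMonoidHom,
        ((Θ.equivMapOfInjective e.permCongrHom.toMonoidHom e.permCongrHom.injective).symm p :
          Equiv.Perm X) = e.symm.permCongr p := by
      intro p
      obtain ⟨q, rfl⟩ :=
        (Θ.equivMapOfInjective e.permCongrHom.toMonoidHom e.permCongrHom.injective).surjective p
      rw [MulEquiv.symm_apply_apply]
      exact (e.permCongr.symm_apply_apply (q : Equiv.Perm X)).symm
    exact ((continuous_permCongr e.symm).comp continuous_subtype_val).congr fun p => (this p).symm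

end Transport

/-! ### Units of endomorphism monoids -/

section Units

open FirstOrder.Language

variable {L L' : FirstOrder.Language.{0, 0}} {A B : Type} [L.Structure A] [L'.Structure B]

theorem permToEnd_mem_endMonoid {g : Equiv.Perm A} (hg : g ∈ autGroup L A) :
    permToEnd g ∈ endMonoid L A := by
  obtain ⟨φ, hφ⟩ := hg
  exact ⟨φ.toHom, hφ⟩

/-- The automorphism group is the group of units of the endomorphism monoid. -/
def autGroupEquivUnits : autGroup L A ≃* (endMonoid L A)ˣ where
  toFun g :=
    { val := ⟨permToEnd g.1, permToEnd_mem_endMonoid g.2⟩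
      inv := ⟨permToEnd g.1⁻¹, permToEnd_mem_endMonoid (inv_mem g.2)⟩
      val_inv := Subtype.ext (funext fun x => g.1.apply_symm_apply x)
      inv_val := Subtype.ext (funext fun x => g.1.symm_apply_apply x) }
  invFun u :=
    ⟨{ toFun := u.val.1
       invFun := u.inv.1
       left_inv := congrFun (congrArg Subtype.val u.inv_val)
       right_inv := congrFun (congrArg Subtype.val u.val_inv) }, by
      obtain ⟨φ, hφ⟩ := u.val.2
      obtain ⟨ψ, hψ⟩ := u.inv.2
      have h1 : ∀ x, ψ (φ x) = x := fun x => by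
        rw [hψ, hφ]
        exact congrFun (congrArg Subtype.val u.inv_val) x
      have h2 : ∀ x, φ (ψ x) = x := fun x => by
        rw [hψ, hφ]
        exact congrFun (congrArg Subtype.val u.val_inv) x
      refine ⟨⟨⟨φ, ψ, h1, h2⟩, fun F x => φ.map_fun F x,
        fun R x => ⟨fun h => ?_, φ.map_rel R x⟩⟩, hφ⟩
      have := ψ.map_rel R _ h
      simpa only [Function.comp_def, Equiv.coe_fn_mk, h1] using this⟩
  left_inv _ := rfl
  right_inv _ := rfl
  map_mul' _ _ := rfl

/-- An isomorphism of endomorphism monoids restricts to one of automorphism groups. -/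
def autGroupEquiv (φ : endMonoid L A ≃* endMonoid L' B) : autGroup L A ≃* autGroup L' B :=
  (autGroupEquivUnits.trans (Units.mapEquiv φ)).trans autGroupEquivUnits.symm

theorem continuous_autGroupEquiv (φ : endMonoid L A ≃* endMonoid L' B) (hφ : Continuous φ) :
    Continuous (autGroupEquiv φ) := by
  refine continuous_induced_rng.2 (continuous_induced_rng.2 ?_)
  have h : Continuous fun g : autGroup L A =>
      (⟨permToEnd g.1, permToEnd_mem_endMonoid g.2⟩ : endMonoid L A) :=
    have h0 : Continuous (permToEnd (X := A)) := continuous_induced_dom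
    (h0.comp continuous_subtype_val).subtype_mk _
  exact (continuous_subtype_val.comp hφ).comp h

/-- A topological isomorphism of endomorphism monoids restricts to one of automorphism groups. -/
def autGroupContinuousEquiv (φ : endMonoid L A ≃ₜ* endMonoid L' B) :
    autGroup L A ≃ₜ* autGroup L' B where
  toMulEquiv := autGroupEquiv φ.toMulEquiv
  continuous_toFun := continuous_autGroupEquiv φ.toMulEquiv φ.continuous
  continuous_invFun := continuous_autGroupEquiv φ.symm.toMulEquiv φ.symm.continuous

end Units

/-! ### Abstract isomorphisms between covers -/

section Abstract

/-- An injective monoid homomorphism is an isomorphism onto its range. -/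
noncomputable def mulEquivOfRange {P E : Type*} [Monoid P] [Monoid E] (Φ : P →* E)
    (hΦ : Function.Injective Φ) (S : Submonoid E) (hS : (S : Set E) = Set.range Φ) : P ≃* S :=
  have hmem : ∀ p, Φ p ∈ S := fun p => by
    rw [← SetLike.mem_coe, hS]
    exact ⟨p, rfl⟩
  MulEquiv.ofBijective (Φ.codRestrict S hmem) ⟨fun p q h => hΦ (congrArg Subtype.val h), by
    rintro ⟨x, hx⟩
    rw [← SetLike.mem_coe, hS] at hx
    obtain ⟨p, rfl⟩ := hx
    exact ⟨p, rfl⟩⟩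

/-- The fiber monoid depends, up to isomorphism, only on the abstract group over `∏ₙ Sym(n)`. -/
def fiberMonoidCongr {M : Type} [partLang.Structure M] {H H' : Type} [Group H] [Group H']
    (ρ : H →* ∀ n : ℕ, Equiv.Perm (Fin n)) (ρ' : H' →* ∀ n : ℕ, Equiv.Perm (Fin n)) (α : H ≃* H')
    (hα : ∀ h, ρ' (α h) = ρ h) : fiberMonoid ρ M ≃* fiberMonoid ρ' M where
  toFun p := ⟨(p.1.1, α p.1.2), by
    change InducesMap p.1.1 (ρ' (α p.1.2))
    rw [hα]
    exact p.2⟩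
  invFun p := ⟨(p.1.1, α.symm p.1.2), by
    change InducesMap p.1.1 (ρ (α.symm p.1.2))
    rw [← hα, α.apply_symm_apply]
    exact p.2⟩
  left_inv p := Subtype.ext (Prod.ext rfl (α.symm_apply_apply _))
  right_inv p := Subtype.ext (Prod.ext rfl (α.apply_symm_apply _))
  map_mul' p q := Subtype.ext (Prod.ext rfl (map_mul α _ _))

end Abstract

/-! ### Covers that do not split topologically -/

section NotSplit

open FirstOrder.Language

variable {M : Type} [partLang.Structure M] {H : Type} [Group H] {Q : Type}
  (ρ : H →* ∀ n : ℕ, Equiv.Perm (Fin n)) (κ : H →* Equiv.Perm Q)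

/-- The pairs of a permutation `g` of `M` and an element `h` of `H` such that `g` induces `ρ h`. -/
def fiberGroup (M : Type) [partLang.Structure M] : Subgroup (Equiv.Perm M × H) where
  carrier := {p | Induces p.1 (ρ p.2)}
  one_mem' := by
    change Induces 1 (ρ 1)
    rw [map_one]
    exact Induces.one
  mul_mem' := by
    intro p q hp hq
    change Induces (p.1 * q.1) (ρ (p.2 * q.2))
    rw [map_mul]
    exact hp.mul hq
  inv_mem' := by
    intro p hp
    change Induces p.1⁻¹ (ρ p.2⁻¹)
    rw [map_inv]
    exact hp.inv

/-- The action of `fiberGroup` on the disjoint union of `M` and `Q`. -/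
def fiberToCover : fiberGroup ρ M →* coverGroup ρ κ M where
  toFun p := ⟨Equiv.sumCongr p.1.1 (κ p.1.2), p.1.1, p.1.2, p.2, rfl⟩
  map_one' := by
    ext (x | x) <;> simp
  map_mul' p q := by
    ext (x | x) <;> simp

theorem fiberToCover_surjective : Function.Surjective (fiberToCover (M := M) ρ κ) := by
  rintro ⟨_, g, h, hg, rfl⟩
  exact ⟨⟨(g, h), hg⟩, rfl⟩

theorem fiberToCover_injective [IsGenericPart M] (hker : ∀ h, ρ h = 1 → κ h = 1 → h = 1) :
    Function.Injective (fiberToCover (M := M) ρ κ) := by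
  refine (injective_iff_map_eq_one _).2 ?_
  rintro ⟨⟨g, h⟩, hg⟩ hgh
  have hp : Equiv.sumCongr g (κ h) = 1 := congrArg Subtype.val hgh
  obtain rfl : g = 1 := Equiv.ext fun x => Sum.inl_injective (Equiv.congr_fun hp (Sum.inl x))
  have hκ : κ h = 1 := Equiv.ext fun q => Sum.inr_injective (Equiv.congr_fun hp (Sum.inr q))
  obtain rfl : h = 1 := hker h (InducesMap.unique (f := id) hg fun _ _ _ => Iff.rfl) hκ
  rfl

/-- If all complements of finite central subgroups of `H` are dense, then the cover is not
topologically isomorphic to a product with a non-trivial finite abelian group `F`: the kernel of the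
projection to `F` is open, so it contains the automorphism group of `M`, and its image in `H` is an
open complement of a finite central subgroup. -/
theorem isEmpty_coverGroup_equiv_prod [IsGenericPart M] [Countable M] [TopologicalSpace H]
    [IsTopologicalGroup H] [Finite Q] (hρ : Continuous ρ) (hκ : IsOpen (κ.ker : Set H))
    (hker : ∀ h, ρ h = 1 → κ h = 1 → h = 1)
    (hdense : ∀ C C' : Subgroup H, Finite C → C ≤ Subgroup.center H →
      Subgroup.IsComplement' C C' → Dense (C' : Set H))
    {T F : Type} [Group T] [TopologicalSpace T] [Group F] [TopologicalSpace F] [Finite F]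
    [Nontrivial F] [DiscreteTopology F] (hcomm : ∀ a b : F, a * b = b * a) :
    IsEmpty (coverGroup ρ κ M ≃ₜ* T × F) := by
  classical
  refine ⟨fun Ψ => ?_⟩
  let ψ : fiberGroup ρ M →* T × F := Ψ.toMulEquiv.toMonoidHom.comp (fiberToCover ρ κ)
  have hψi : Function.Injective ψ := Ψ.injective.comp (fiberToCover_injective ρ κ hker)
  have hψs : Function.Surjective ψ := Ψ.surjective.comp (fiberToCover_surjective ρ κ)
  let χ : fiberGroup ρ M →* F := (MonoidHom.snd T F).comp ψ
  let τ : fiberGroup ρ M →* T := (MonoidHom.fst T F).comp ψ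
  let π : fiberGroup ρ M →* H := (MonoidHom.snd _ _).comp (fiberGroup ρ M).subtype
  have hτχ : ∀ p, τ p = 1 → χ p = 1 → p = 1 := fun p h1 h2 =>
    hψi ((Prod.ext h1 h2).trans (map_one ψ).symm)
  have hπs : Function.Surjective π := fun h => by
    obtain ⟨g, hg, -⟩ := exists_perm_extending (M := M) (ρ h) ∅ id (fun n i x hx => by
      exact absurd (hx ⟨0, by have := i.2; omega⟩) (by simp))
    exact ⟨⟨(g, h), hg⟩, rfl⟩
  -- the kernel of `χ` is open
  have hopen : ∃ s : Finset M, ∀ p : fiberGroup ρ M, (∀ a ∈ s, p.1.1 a = a) → κ p.1.2 = 1 →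
      χ p = 1 := by
    have hU : IsOpen {q : coverGroup ρ κ M | (Ψ q).2 = 1} :=
      (isOpen_discrete {(1 : F)}).preimage (continuous_snd.comp Ψ.continuous)
    obtain ⟨V, hV, hVU⟩ := isOpen_induced_iff.1 hU
    obtain ⟨W, hW, hWV⟩ := isOpen_induced_iff.1 hV
    have h1 : permToEnd (1 : Equiv.Perm (M ⊕ Q)) ∈ W := by
      have : (1 : coverGroup ρ κ M) ∈ {q : coverGroup ρ κ M | (Ψ q).2 = 1} := by
        change (Ψ 1).2 = 1
        rw [map_one]
        rfl
      rw [← hVU, ← hWV] at this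
      exact this
    obtain ⟨s, hs⟩ := exists_finset_agree_subset hW h1
    refine ⟨s.toLeft, fun p hp hpκ => ?_⟩
    have : fiberToCover ρ κ p ∈ {q : coverGroup ρ κ M | (Ψ q).2 = 1} := by
      rw [← hVU, ← hWV]
      refine hs _ ?_
      rintro (a | q) hx
      · exact congrArg Sum.inl (hp a (by simpa using hx))
      · change Sum.inr (κ p.1.2 q) = Sum.inr q
        rw [hpκ]
        rfl
    exact this
  obtain ⟨s, hs⟩ := hopen
  -- it contains the automorphism group of `M`
  have haut : ∀ p, π p = 1 → χ p = 1 := by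
    rintro ⟨⟨g, h⟩, hg⟩ (rfl : h = 1)
    let N : Subgroup (Equiv.Perm M) :=
      (χ.ker ⊓ π.ker).map ((MonoidHom.fst _ _).comp (fiberGroup ρ M).subtype)
    have hmem : ∀ g, g ∈ N ↔ ∃ hg : Induces g (ρ 1), χ ⟨(g, 1), hg⟩ = 1 := by
      intro g
      constructor
      · rintro ⟨⟨⟨g', h⟩, hg'⟩, ⟨h1, (h2 : h = 1)⟩, rfl⟩
        subst h2
        exact ⟨hg', h1⟩
      · rintro ⟨hg, h⟩
        exact ⟨_, ⟨h, rfl⟩, rfl⟩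
    have hgN : g ∈ N := by
      refine mem_of_stabilizer_le N ?_ s ?_ g (by rw [← map_one ρ]; exact hg)
      · intro g k hgN hk
        obtain ⟨hg, hgχ⟩ := (hmem g).1 hgN
        have hk' : Induces k (ρ 1) := by rwa [map_one]
        have hp : (⟨(k, 1), hk'⟩ : fiberGroup ρ M) * ⟨(g, 1), hg⟩ * ⟨(k, 1), hk'⟩⁻¹ ∈ χ.ker := by
          rw [MonoidHom.mem_ker, map_mul, map_mul, hgχ, mul_one, map_inv, mul_inv_cancel]
        refine ⟨_, ⟨hp, ?_⟩, rfl⟩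
        change (1 : H) * 1 * 1⁻¹ = 1
        simp
      · intro g hg hgs
        have hg' : Induces g (ρ 1) := by rwa [map_one]
        exact (hmem g).2 ⟨hg', hs ⟨(g, 1), hg'⟩ hgs (map_one κ)⟩
    exact ((hmem g).1 hgN).2
  let C : Subgroup H := τ.ker.map π
  let D : Subgroup H := χ.ker.map π
  have hC : Finite C := by
    have : Finite τ.ker := Finite.of_injective (fun p => χ p.1) fun p q hpq => by
      refine Subtype.ext (hψi (Prod.ext (p.2.trans q.2.symm) hpq))
    exact Finite.of_surjective (fun p : τ.ker => (⟨π p.1, p.1, p.2, rfl⟩ : C))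
      (by rintro ⟨_, p, hp, rfl⟩; exact ⟨⟨p, hp⟩, rfl⟩)
  have hCc : C ≤ Subgroup.center H := by
    rintro _ ⟨p, hp, rfl⟩
    refine Subgroup.mem_center_iff.2 fun h => ?_
    obtain ⟨q, rfl⟩ := hπs h
    rw [← map_mul, ← map_mul]
    refine congrArg π (hψi (Prod.ext ?_ ?_))
    · change τ (q * p) = τ (p * q)
      rw [map_mul, map_mul, show τ p = 1 from hp, mul_one, one_mul]
    · change χ (q * p) = χ (p * q)
      rw [map_mul, map_mul, hcomm]
  have hCD : Subgroup.IsComplement' C D := by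
    refine Subgroup.isComplement'_of_disjoint_and_mul_eq_univ ?_ ?_
    · rw [Subgroup.disjoint_def]
      rintro _ ⟨p, hp, rfl⟩ ⟨q, hq, hqp⟩
      have h1 : χ (p * q⁻¹) = 1 := haut _ (by rw [map_mul, map_inv, hqp, mul_inv_cancel])
      rw [map_mul, map_inv, show χ q = 1 from hq, inv_one, mul_one] at h1
      rw [hτχ p hp h1, map_one]
    · refine Set.eq_univ_of_forall fun h => ?_
      obtain ⟨p, rfl⟩ := hπs h
      obtain ⟨q, hq⟩ := hψs (1, χ p)
      have hq2 : (ψ q).2 = χ p := by rw [hq]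
      have hq2 : χ q = χ p := hq2
      refine ⟨π q, ⟨q, congrArg Prod.fst hq, rfl⟩, π (q⁻¹ * p), ⟨_, ?_, rfl⟩, ?_⟩
      · change χ (q⁻¹ * p) = 1
        rw [map_mul, map_inv, hq2, inv_mul_cancel]
      · change π q * π (q⁻¹ * p) = π p
        rw [← map_mul, mul_inv_cancel_left]
  have hDo : IsOpen (D : Set H) := by
    refine D.isOpen_of_mem_nhds (g := 1) (Filter.mem_of_superset (IsOpen.mem_nhds
      ((isOpen_setOf_eq hκ 1).inter ((Set.finite_Iic s.card).isOpen_biInter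
        fun n _ => isOpen_setOf_apply_eq hρ n 1)) ⟨rfl, by simp⟩) ?_)
    rintro h ⟨h1, h2⟩
    simp only [Set.mem_iInter] at h2
    obtain ⟨g, hg, hgs⟩ := InducesMap.exists_perm (M := M) (f := id) (σ := 1) (τ := ρ h)
      (fun _ _ _ => Iff.rfl) s (fun n hn => by
        have : ρ h n = ρ 1 n := h2 n hn
        rw [this, map_one])
    refine ⟨⟨(g, h), hg⟩, hs _ hgs ?_, rfl⟩
    have : κ h = κ 1 := h1
    rw [this, map_one]
  have hDt : D = ⊤ := by
    refine SetLike.coe_injective ?_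
    rw [Subgroup.coe_top, ← (hdense C D hC hCc hCD).closure_eq]
    exact (D.isClosed_of_isOpen hDo).closure_eq.symm
  have hCb : ∀ h ∈ C, h = 1 := fun h hh =>
    Subgroup.disjoint_def.1 hCD.disjoint hh (hDt ▸ Subgroup.mem_top h)
  obtain ⟨c, hc⟩ := exists_ne (1 : F)
  obtain ⟨p, hp⟩ := hψs (1, c)
  have h1 : χ p = 1 := haut p (hCb _ ⟨p, congrArg Prod.fst hp, rfl⟩)
  exact hc ((congrArg Prod.snd hp).symm.trans h1)

end NotSplit

/-! ### A profinite group of nilpotency class two with dense complements -/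

/-- The pairs `(i, j)` of natural numbers with `i < j`. -/
abbrev UpperPair : Type := {p : ℕ × ℕ // p.1 < p.2}

/-- The strictly upper triangular part of the matrix `(vᵢ wⱼ)`. -/
def upperMul (v w : ℕ → ZMod 2) : UpperPair → ZMod 2 := fun p => v p.1.1 * w p.1.2

/-- The set underlying the profinite group of class two: pairs of a vector over `ZMod 2` and a
strictly upper triangular matrix over `ZMod 2`, both infinite. -/
def UpperGroup : Type := (ℕ → ZMod 2) × (UpperPair → ZMod 2)

namespace UpperGroup

instance : TopologicalSpace UpperGroup :=
  inferInstanceAs (TopologicalSpace ((ℕ → ZMod 2) × (UpperPair → ZMod 2)))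

instance : CompactSpace UpperGroup :=
  inferInstanceAs (CompactSpace ((ℕ → ZMod 2) × (UpperPair → ZMod 2)))

instance : T2Space UpperGroup :=
  inferInstanceAs (T2Space ((ℕ → ZMod 2) × (UpperPair → ZMod 2)))

instance : TotallyDisconnectedSpace UpperGroup :=
  inferInstanceAs (TotallyDisconnectedSpace ((ℕ → ZMod 2) × (UpperPair → ZMod 2)))

instance : SecondCountableTopology UpperGroup :=
  inferInstanceAs (SecondCountableTopology ((ℕ → ZMod 2) × (UpperPair → ZMod 2)))

/-- The multiplication `(v, a) (w, b) = (v + w, a + b + (vᵢ wⱼ)_{i < j})`. -/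
instance : Mul UpperGroup := ⟨fun x y => (x.1 + y.1, x.2 + y.2 + upperMul x.1 y.1)⟩

instance : One UpperGroup := ⟨((0 : ℕ → ZMod 2), (0 : UpperPair → ZMod 2))⟩

instance : Inv UpperGroup := ⟨fun x => (-x.1, -x.2 + upperMul x.1 x.1)⟩

theorem ext {x y : UpperGroup} (h1 : ∀ i, x.1 i = y.1 i) (h2 : ∀ p, x.2 p = y.2 p) : x = y :=
  Prod.ext (funext h1) (funext h2)

theorem mul_fst (x y : UpperGroup) (i : ℕ) : (x * y).1 i = x.1 i + y.1 i := rfl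

theorem mul_snd (x y : UpperGroup) (p : UpperPair) :
    (x * y).2 p = x.2 p + y.2 p + x.1 p.1.1 * y.1 p.1.2 := rfl

theorem one_fst (i : ℕ) : (1 : UpperGroup).1 i = 0 := rfl

theorem one_snd (p : UpperPair) : (1 : UpperGroup).2 p = 0 := rfl

theorem inv_fst (x : UpperGroup) (i : ℕ) : x⁻¹.1 i = -x.1 i := rfl

theorem inv_snd (x : UpperGroup) (p : UpperPair) :
    x⁻¹.2 p = -x.2 p + x.1 p.1.1 * x.1 p.1.2 := rfl

instance : Group UpperGroup := Group.ofLeftAxioms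
  (fun x y z => ext (fun i => by simp only [mul_fst]; ring)
    (fun p => by simp only [mul_snd, mul_fst]; ring))
  (fun x => ext (fun i => by rw [mul_fst, one_fst, zero_add])
    (fun p => by rw [mul_snd, one_snd, one_fst]; ring))
  (fun x => ext (fun i => by rw [mul_fst, inv_fst, one_fst]; ring)
    (fun p => by rw [mul_snd, inv_snd, inv_fst, one_snd]; ring))

theorem continuous_fst_apply (i : ℕ) : Continuous fun x : UpperGroup => x.1 i :=
  (continuous_apply i).comp continuous_fst

theorem continuous_snd_apply (p : UpperPair) : Continuous fun x : UpperGroup => x.2 p :=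
  (continuous_apply p).comp continuous_snd

theorem continuous_of_apply {Y : Type*} [TopologicalSpace Y] {f : Y → UpperGroup}
    (h1 : ∀ i, Continuous fun y => (f y).1 i) (h2 : ∀ p, Continuous fun y => (f y).2 p) :
    Continuous f :=
  Continuous.prodMk (continuous_pi h1) (continuous_pi h2)

instance : IsTopologicalGroup UpperGroup where
  continuous_mul := continuous_of_apply
    (fun i => ((continuous_fst_apply i).comp continuous_fst).add
      ((continuous_fst_apply i).comp continuous_snd))
    (fun p => (((continuous_snd_apply p).comp continuous_fst).add
      ((continuous_snd_apply p).comp continuous_snd)).add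
      (((continuous_fst_apply p.1.1).comp continuous_fst).mul
        ((continuous_fst_apply p.1.2).comp continuous_snd)))
  continuous_inv := continuous_of_apply
    (fun i => (continuous_fst_apply i).neg)
    (fun p => (continuous_snd_apply p).neg.add
      ((continuous_fst_apply p.1.1).mul (continuous_fst_apply p.1.2)))

/-- The element with a given matrix and trivial vector. -/
def ofMatrix (b : UpperPair → ZMod 2) : UpperGroup := ((0 : ℕ → ZMod 2), b)

/-- The element with a given vector and trivial matrix. -/
def ofVector (v : ℕ → ZMod 2) : UpperGroup := (v, (0 : UpperPair → ZMod 2))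

theorem ofMatrix_fst (b : UpperPair → ZMod 2) (i : ℕ) : (ofMatrix b).1 i = 0 := rfl

theorem ofMatrix_snd (b : UpperPair → ZMod 2) (p : UpperPair) : (ofMatrix b).2 p = b p := rfl

theorem ofVector_fst (v : ℕ → ZMod 2) (i : ℕ) : (ofVector v).1 i = v i := rfl

theorem ofVector_snd (v : ℕ → ZMod 2) (p : UpperPair) : (ofVector v).2 p = 0 := rfl

theorem ofMatrix_zero : ofMatrix 0 = 1 := rfl

theorem ofMatrix_add (a b : UpperPair → ZMod 2) : ofMatrix (a + b) = ofMatrix a * ofMatrix b :=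
  ext (fun i => by simp [mul_fst, ofMatrix_fst])
    (fun p => by simp [mul_snd, ofMatrix_fst, ofMatrix_snd])

theorem continuous_ofMatrix : Continuous ofMatrix :=
  continuous_of_apply (fun _ => continuous_const) (fun p => continuous_apply p)

theorem ofMatrix_mem_center (b : UpperPair → ZMod 2) :
    ofMatrix b ∈ Subgroup.center UpperGroup := by
  refine Subgroup.mem_center_iff.2 fun x => ext (fun i => ?_) (fun p => ?_)
  · simp only [mul_fst, ofMatrix_fst]; ring
  · simp only [mul_snd, ofMatrix_fst, ofMatrix_snd]; ring

theorem eq_ofMatrix_of_mem_center {x : UpperGroup} (hx : x ∈ Subgroup.center UpperGroup) :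
    x = ofMatrix x.2 := by
  refine ext (fun i => ?_) (fun p => rfl)
  have := congrArg (fun y : UpperGroup => y.2 ⟨(i, i + 1), Nat.lt_succ_self i⟩)
    (Subgroup.mem_center_iff.1 hx (ofVector (Pi.single (i + 1) 1)))
  simp only [mul_snd, ofVector_fst, ofVector_snd, Pi.single_apply] at this
  simpa [ofMatrix_fst] using this.symm

/-- The matrix unit at `(i, j)` is a commutator of vectors. -/
theorem ofMatrix_single (p : UpperPair) :
    ofMatrix (Pi.single p 1) = ofVector (Pi.single p.1.1 1) * ofVector (Pi.single p.1.2 1) *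
      (ofVector (Pi.single p.1.1 1))⁻¹ * (ofVector (Pi.single p.1.2 1))⁻¹ := by
  rw [eq_mul_inv_iff_mul_eq, eq_mul_inv_iff_mul_eq]
  refine ext (fun i => ?_) (fun q => ?_)
  · simp only [mul_fst, ofMatrix_fst, ofVector_fst]; ring
  · simp only [mul_snd, mul_fst, ofMatrix_fst, ofMatrix_snd, ofVector_fst, ofVector_snd,
      Pi.single_apply]
    obtain ⟨⟨i, j⟩, hij⟩ := p
    obtain ⟨⟨k, l⟩, hkl⟩ := q
    simp only [Subtype.mk.injEq, Prod.mk.injEq] at hij hkl ⊢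
    by_cases h1 : k = i <;> by_cases h2 : l = j <;> by_cases h3 : k = j <;> by_cases h4 : l = i <;>
      simp [h1, h2, h3, h4] <;> omega

/-- Complements of central subgroups contain all commutators, hence all matrices of finite support,
so their closure contains the centre. -/
theorem dense_of_isComplement' {C D : Subgroup UpperGroup} (hC : C ≤ Subgroup.center UpperGroup)
    (hCD : Subgroup.IsComplement' C D) : Dense (D : Set UpperGroup) := by
  have hdec : ∀ x : UpperGroup, ∃ c ∈ C, ∃ d ∈ D, c * d = x := fun x => by
    obtain ⟨⟨⟨c, hc⟩, ⟨d, hd⟩⟩, h⟩ := hCD.2 x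
    exact ⟨c, hc, d, hd, h⟩
  have hcomm : ∀ x y : UpperGroup, x * y * x⁻¹ * y⁻¹ ∈ D := by
    intro x y
    obtain ⟨c, hc, d, hd, rfl⟩ := hdec x
    obtain ⟨c', hc', d', hd', rfl⟩ := hdec y
    have h1 := Subgroup.mem_center_iff.1 (hC hc)
    have h2 := Subgroup.mem_center_iff.1 (hC hc')
    have : c * d * (c' * d') * (c * d)⁻¹ * (c' * d')⁻¹ = d * d' * d⁻¹ * d'⁻¹ := by
      rw [mul_inv_eq_iff_eq_mul, mul_inv_eq_iff_eq_mul]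
      calc c * d * (c' * d') = d * (c * d') * c' := by rw [← h1 d, ← h2 d']; group
        _ = d * d' * (c * c') := by rw [← h1 d']; group
        _ = d * d' * d⁻¹ * (d * c') * c := by rw [h2 c]; group
        _ = d * d' * d⁻¹ * d'⁻¹ * (d' * c') * (d * c) := by rw [h2 d]; group
        _ = _ := by rw [h2 d', h1 d]
    rw [this]
    exact D.mul_mem (D.mul_mem (D.mul_mem hd hd') (D.inv_mem hd)) (D.inv_mem hd')
  have hfin : ∀ (b : UpperPair → ZMod 2) (s : Finset UpperPair),
      ofMatrix (∑ p ∈ s, Pi.single p (b p)) ∈ D := by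
    intro b s
    refine Finset.sum_induction _ (fun a => ofMatrix a ∈ D) (fun a a' ha ha' => ?_) ?_ fun p _ => ?_
    · rw [ofMatrix_add]
      exact D.mul_mem ha ha'
    · rw [ofMatrix_zero]
      exact D.one_mem
    · have h01 : ∀ t : ZMod 2, t = 0 ∨ t = 1 := by decide
      rcases h01 (b p) with h | h
      · rw [h, Pi.single_zero, ofMatrix_zero]
        exact D.one_mem
      · rw [h, ofMatrix_single]
        exact hcomm _ _
  have hmat : ∀ b : UpperPair → ZMod 2, ofMatrix b ∈ D.topologicalClosure := by
    intro b
    have ht : Filter.Tendsto (fun s : Finset UpperPair => ∑ p ∈ s, (Pi.single p (b p) :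
        UpperPair → ZMod 2)) Filter.atTop (nhds b) := by
      refine tendsto_pi_nhds.2 fun p => tendsto_const_nhds.congr' ?_
      filter_upwards [Filter.eventually_ge_atTop {p}] with s hs
      rw [Finset.sum_apply, Finset.sum_eq_single p, Pi.single_eq_same]
      · intro q _ hq
        exact Pi.single_eq_of_ne hq.symm _
      · exact fun h => absurd (hs (Finset.mem_singleton_self p)) h
    exact mem_closure_of_tendsto ((continuous_ofMatrix.tendsto b).comp ht)
      (Filter.Eventually.of_forall fun s => hfin b s)
  intro x
  obtain ⟨c, hc, d, hd, rfl⟩ := hdec x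
  rw [eq_ofMatrix_of_mem_center (hC hc)]
  exact D.topologicalClosure.mul_mem (hmat _) (D.le_topologicalClosure hd)

/-- The matrix with entry `1` at `(i, j)` if `i` is the first component of the pair coded by `j`:
any two different rows differ at arbitrarily large indices. -/
def farMatrix : UpperPair → ZMod 2 := fun p => if (Nat.unpair p.1.2).1 = p.1.1 then 1 else 0

/-- The rows of a matrix in the span of the `upperMul v w` carry finitely many labels such that rows
with the same label agree wherever both are defined. -/
theorem exists_finite_rows {b : UpperPair → ZMod 2}
    (hb : b ∈ Submodule.span (ZMod 2) (Set.range fun q : (ℕ → ZMod 2) × (ℕ → ZMod 2) =>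
      upperMul q.1 q.2)) :
    ∃ (I : Type) (_ : Finite I) (c : ℕ → I), ∀ (i i' j : ℕ) (h : i < j) (h' : i' < j), c i = c i' →
      b ⟨(i, j), h⟩ = b ⟨(i', j), h'⟩ := by
  induction hb using Submodule.span_induction with
  | mem b hb =>
    obtain ⟨⟨v, w⟩, rfl⟩ := hb
    exact ⟨ZMod 2, inferInstance, v, fun i i' j h h' hc => by simp only [upperMul, hc]⟩
  | zero => exact ⟨Unit, inferInstance, fun _ => (), fun _ _ _ _ _ _ => rfl⟩
  | add a b _ _ ha hb =>
    obtain ⟨I, hI, c, hc⟩ := ha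
    obtain ⟨J, hJ, d, hd⟩ := hb
    refine ⟨I × J, inferInstance, fun i => (c i, d i), fun i i' j h h' hcd => ?_⟩
    rw [Pi.add_apply, Pi.add_apply, hc i i' j h h' (congrArg Prod.fst hcd),
      hd i i' j h h' (congrArg Prod.snd hcd)]
  | smul t b _ hb =>
    obtain ⟨I, hI, c, hc⟩ := hb
    exact ⟨I, hI, c, fun i i' j h h' hi => by
      rw [Pi.smul_apply, Pi.smul_apply, hc i i' j h h' hi]⟩

theorem farMatrix_notMem_span : farMatrix ∉ Submodule.span (ZMod 2)
    (Set.range fun q : (ℕ → ZMod 2) × (ℕ → ZMod 2) => upperMul q.1 q.2) := by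
  intro h
  obtain ⟨I, hI, c, hc⟩ := exists_finite_rows h
  obtain ⟨i, i', hne, hci⟩ := Finite.exists_ne_map_eq_of_infinite c
  have hj : i + i' + 1 ≤ Nat.pair i (i + i' + 1) := Nat.right_le_pair _ _
  have := hc i i' (Nat.pair i (i + i' + 1)) (by omega) (by omega) hci
  simp [farMatrix, hne] at this

theorem exists_functional : ∃ φ : (UpperPair → ZMod 2) →ₗ[ZMod 2] ZMod 2,
    (∀ v w, φ (upperMul v w) = 0) ∧ φ farMatrix = 1 := by
  obtain ⟨φ, hφ, hle⟩ := Submodule.exists_le_ker_of_notMem farMatrix_notMem_span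
  refine ⟨φ, fun v w => hle (Submodule.subset_span ⟨(v, w), rfl⟩), ?_⟩
  have h01 : ∀ t : ZMod 2, t ≠ 0 → t = 1 := by decide
  exact h01 _ hφ

theorem ofMatrix_mul_self (b : UpperPair → ZMod 2) : ofMatrix b * ofMatrix b = 1 := by
  rw [← ofMatrix_add, show b + b = 0 from funext fun p => CharTwo.add_self_eq_zero (b p),
    ofMatrix_zero]

/-- The central subgroup of order two generated by `farMatrix`. -/
def farSubgroup : Subgroup UpperGroup where
  carrier := {1, ofMatrix farMatrix}
  one_mem' := Or.inl rfl
  mul_mem' := by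
    rintro _ _ (rfl | rfl) (rfl | rfl)
    · exact Or.inl (mul_one 1)
    · exact Or.inr (one_mul _)
    · exact Or.inr (mul_one _)
    · exact Or.inl (ofMatrix_mul_self _)
  inv_mem' := by
    rintro _ (rfl | rfl)
    · exact Or.inl inv_one
    · exact Or.inr (inv_eq_of_mul_eq_one_left (ofMatrix_mul_self _))

theorem mem_farSubgroup {x : UpperGroup} :
    x ∈ farSubgroup ↔ x = 1 ∨ x = ofMatrix farMatrix := Iff.rfl

theorem farSubgroup_le_center : farSubgroup ≤ Subgroup.center UpperGroup := by
  rintro _ (rfl | rfl)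
  · exact Subgroup.one_mem _
  · exact ofMatrix_mem_center _

instance : farSubgroup.Normal :=
  ⟨fun x hx g => by
    rw [Subgroup.mem_center_iff.1 (farSubgroup_le_center hx) g, mul_inv_cancel_right]
    exact hx⟩

theorem farMatrix_zero_one : farMatrix ⟨(0, 1), zero_lt_one⟩ = 1 := by
  have : (Nat.unpair 1).1 = 0 := by decide
  simp [farMatrix, this]

/-- The normal subgroup of all elements that vanish on indices below `k`. -/
def vanishing (k : ℕ) : Subgroup UpperGroup where
  carrier := {x | (∀ i < k, x.1 i = 0) ∧ ∀ p : UpperPair, p.1.2 < k → x.2 p = 0}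
  one_mem' := ⟨fun _ _ => rfl, fun _ _ => rfl⟩
  mul_mem' := by
    rintro x y ⟨hx1, hx2⟩ ⟨hy1, hy2⟩
    refine ⟨fun i hi => by rw [mul_fst, hx1 i hi, hy1 i hi, add_zero], fun p hp => ?_⟩
    rw [mul_snd, hx2 p hp, hy2 p hp, hy1 _ hp, mul_zero, add_zero, add_zero]
  inv_mem' := by
    rintro x ⟨hx1, hx2⟩
    refine ⟨fun i hi => by rw [inv_fst, hx1 i hi, neg_zero], fun p hp => ?_⟩
    rw [inv_snd, hx2 p hp, hx1 _ hp, mul_zero, neg_zero, add_zero]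

theorem mem_vanishing {k : ℕ} {x : UpperGroup} : x ∈ vanishing k ↔
    (∀ i < k, x.1 i = 0) ∧ ∀ p : UpperPair, p.1.2 < k → x.2 p = 0 := Iff.rfl

instance (k : ℕ) : (vanishing k).Normal := by
  refine ⟨fun x ⟨hx1, hx2⟩ g => ⟨fun i hi => ?_, fun p hp => ?_⟩⟩
  · rw [mul_fst, mul_fst, inv_fst, hx1 i hi]; ring
  · rw [mul_snd, mul_snd, mul_fst, inv_fst, inv_snd, hx2 p hp, hx1 _ hp, hx1 _ (p.2.trans hp)]; ring

theorem isOpen_vanishing (k : ℕ) : IsOpen (vanishing k : Set UpperGroup) := by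
  have hfin : {p : UpperPair | p.1.2 < k}.Finite :=
    (((Set.finite_Iio k).prod (Set.finite_Iio k)).preimage Subtype.val_injective.injOn).subset
      fun p hp => ⟨p.2.trans hp, hp⟩
  have : (vanishing k : Set UpperGroup) = (⋂ i ∈ Set.Iio k, (fun x : UpperGroup => x.1 i) ⁻¹' {0}) ∩
      ⋂ p ∈ {p : UpperPair | p.1.2 < k}, (fun x : UpperGroup => x.2 p) ⁻¹' {0} := by
    ext x
    simp [mem_vanishing]
  rw [this]
  exact ((Set.finite_Iio k).isOpen_biInter fun i _ =>
    (isOpen_discrete _).preimage (continuous_fst_apply i)).inter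
    (hfin.isOpen_biInter fun p _ => (isOpen_discrete _).preimage (continuous_snd_apply p))

theorem vanishing_antitone : Antitone vanishing := fun _ _ h _ hx =>
  ⟨fun i hi => hx.1 i (hi.trans_le h), fun p hp => hx.2 p (hp.trans_le h)⟩

theorem eq_one_of_forall_mem_vanishing {x : UpperGroup} (h : ∀ k, x ∈ vanishing k) : x = 1 :=
  ext (fun i => (h (i + 1)).1 i (Nat.lt_succ_self i))
    (fun p => (h (p.1.2 + 1)).2 p (Nat.lt_succ_self _))

theorem vanishing_inf_farSubgroup : vanishing 2 ⊓ farSubgroup = ⊥ := by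
  rw [eq_bot_iff]
  rintro x ⟨hx, rfl | rfl⟩
  · rfl
  · have := hx.2 ⟨(0, 1), zero_lt_one⟩ one_lt_two
    rw [ofMatrix_snd, farMatrix_zero_one] at this
    exact absurd this one_ne_zero

theorem mem_farSubgroup_of_forall {x : UpperGroup} (h : ∀ k, x ∈ vanishing k ⊔ farSubgroup) :
    x ∈ farSubgroup := by
  by_contra hx
  rw [mem_farSubgroup, not_or] at hx
  obtain ⟨h1, h2⟩ := hx
  obtain ⟨k, hk⟩ : ∃ k, x ∉ vanishing k := by
    by_contra! hall
    exact h1 (eq_one_of_forall_mem_vanishing hall)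
  obtain ⟨l, hl⟩ : ∃ l, x * (ofMatrix farMatrix)⁻¹ ∉ vanishing l := by
    by_contra! hall
    exact h2 (mul_inv_eq_one.1 (eq_one_of_forall_mem_vanishing hall))
  obtain ⟨y, hy, f, hf, hyf⟩ := Subgroup.mem_sup_of_normal_right.1 (h (max k l))
  rcases hf with rfl | rfl
  · rw [mul_one] at hyf
    exact hk (vanishing_antitone (le_max_left k l) (hyf ▸ hy))
  · rw [← hyf, mul_inv_cancel_right] at hl
    exact hl (vanishing_antitone (le_max_right k l) hy)

/-- The functional killing all `upperMul v w`, as a homomorphism of groups. -/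
def functionalHom (φ : (UpperPair → ZMod 2) →ₗ[ZMod 2] ZMod 2)
    (hφ : ∀ v w, φ (upperMul v w) = 0) : UpperGroup →* Multiplicative (ZMod 2) where
  toFun x := Multiplicative.ofAdd (φ x.2)
  map_one' := congrArg Multiplicative.ofAdd (map_zero φ)
  map_mul' x y := by
    rw [← ofAdd_add, ← map_add]
    change Multiplicative.ofAdd (φ (x.2 + y.2 + upperMul x.1 y.1)) = _
    rw [map_add, hφ, add_zero]

theorem exists_isDenselyComplemented :
    ∃ D : Subgroup UpperGroup, IsDenselyComplemented farSubgroup D := by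
  obtain ⟨φ, hφ, hφ1⟩ := exists_functional
  have hcompl : Subgroup.IsComplement' farSubgroup (functionalHom φ hφ).ker := by
    have hfar : functionalHom φ hφ (ofMatrix farMatrix) = Multiplicative.ofAdd 1 :=
      congrArg Multiplicative.ofAdd hφ1
    refine Subgroup.isComplement'_of_disjoint_and_mul_eq_univ ?_ ?_
    · rw [Subgroup.disjoint_def]
      rintro x (rfl | rfl) hx
      · rfl
      · rw [MonoidHom.mem_ker, hfar] at hx
        exact absurd hx (by decide)
    · refine Set.eq_univ_of_forall fun x => ?_
      have h01 : ∀ t : Multiplicative (ZMod 2), t = 1 ∨ Multiplicative.ofAdd 1 * t = 1 := by decide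
      rcases h01 (functionalHom φ hφ x) with h | h
      · exact ⟨1, farSubgroup.one_mem, x, h, one_mul x⟩
      · refine ⟨ofMatrix farMatrix, Or.inr rfl, ofMatrix farMatrix * x, ?_, ?_⟩
        · change functionalHom φ hφ _ = 1
          rw [map_mul, hfar, h]
        · change ofMatrix farMatrix * (ofMatrix farMatrix * x) = x
          rw [← mul_assoc, ofMatrix_mul_self, one_mul]
  refine ⟨_, ⟨?_, ?_, farSubgroup_le_center, hcompl,
    dense_of_isComplement' farSubgroup_le_center hcompl,
    fun C C' _ hC hCC' => dense_of_isComplement' hC hCC'⟩⟩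
  · intro h
    have h1 : ofMatrix farMatrix ∈ farSubgroup := Or.inr rfl
    rw [h, Subgroup.mem_bot] at h1
    have := congrArg (fun x : UpperGroup => x.2 ⟨(0, 1), zero_lt_one⟩) h1
    simp only [ofMatrix_snd, farMatrix_zero_one, one_snd] at this
    exact absurd this one_ne_zero
  · exact Set.Finite.to_subtype (Set.toFinite ({1, ofMatrix farMatrix} : Set UpperGroup))

end UpperGroup

/-! ### Representations in the product of the finite symmetric groups -/

/-- A normal subgroup acts trivially on its cosets. -/
theorem toPermHom_eq_one_of_mem {G : Type*} [Group G] {N : Subgroup G} [hN : N.Normal] {x : G}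
    (hx : x ∈ N) : MulAction.toPermHom G (G ⧸ N) x = 1 := by
  ext ⟨g⟩
  refine QuotientGroup.eq.2 ?_
  have := hN.conj_mem x⁻¹ (inv_mem hx) g⁻¹
  simpa [mul_assoc] using this

theorem mem_of_toPermHom_eq_one {G : Type*} [Group G] {N : Subgroup G} [hN : N.Normal] {x : G}
    (hx : MulAction.toPermHom G (G ⧸ N) x = 1) : x ∈ N := by
  have : (QuotientGroup.mk (x * 1) : G ⧸ N) = QuotientGroup.mk 1 :=
    Equiv.congr_fun hx (QuotientGroup.mk 1)
  rwa [mul_one, QuotientGroup.mk_one, QuotientGroup.eq_one_iff] at this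

/-- A group that is separated by a sequence of continuous actions on finite sets embeds continuously
in `∏ₙ Sym(n)`: the `k`-th action occurs in arbitrarily large symmetric groups. -/
theorem exists_injective_continuous {R : Type} [Group R] [TopologicalSpace R]
    [IsTopologicalGroup R] (Y : ℕ → Type) [∀ k, Finite (Y k)] (θ : ∀ k, R →* Equiv.Perm (Y k))
    (hopen : ∀ k, IsOpen ((θ k).ker : Set R)) (hsep : ∀ r, (∀ k, θ k r = 1) → r = 1) :
    ∃ ι : R →* ∀ n : ℕ, Equiv.Perm (Fin n), Continuous ι ∧ Function.Injective ι := by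
  classical
  have hemb : ∀ n k : ℕ, Nat.card (Y k) ≤ n → Nonempty (Y k ↪ Fin n) := fun n k h =>
    ⟨(Finite.equivFin (Y k)).toEmbedding.trans (Fin.castLEEmb h)⟩
  let a : ∀ n, R →* Equiv.Perm (Fin n) := fun n =>
    if h : Nat.card (Y (Nat.unpair n).1) ≤ n then
      (Equiv.Perm.viaEmbeddingHom (hemb n _ h).some).comp (θ (Nat.unpair n).1) else 1
  refine ⟨MonoidHom.pi a, continuous_pi fun n => ?_,
    (injective_iff_map_eq_one _).2 fun r hr => hsep r fun k => ?_⟩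
  · refine (IsLocallyConstant.iff_exists_open _).2 (fun r => ?_) |>.continuous
    refine ⟨{s | θ (Nat.unpair n).1 s = θ (Nat.unpair n).1 r}, ?_, rfl, fun s hs => ?_⟩
    · exact isOpen_setOf_eq (hopen _) r
    · have hs' : θ (Nat.unpair n).1 s = θ (Nat.unpair n).1 r := hs
      change a n s = a n r
      by_cases h : Nat.card (Y (Nat.unpair n).1) ≤ n
      · simp only [a, dif_pos h, MonoidHom.comp_apply, hs']
      · simp only [a, dif_neg h, MonoidHom.one_apply]
  · let n := Nat.pair k (Nat.card (Y k))
    have hk : (Nat.unpair n).1 = k := by simp [n]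
    have hn : Nat.card (Y (Nat.unpair n).1) ≤ n := by
      rw [hk]
      exact Nat.right_le_pair _ _
    have : a n r = 1 := congrFun hr n
    simp only [a, dif_pos hn, MonoidHom.comp_apply] at this
    rw [← map_one (Equiv.Perm.viaEmbeddingHom (hemb n _ hn).some)] at this
    have := Equiv.Perm.viaEmbeddingHom_injective _ this
    rw [← hk]
    exact this

namespace UpperGroup

theorem exists_representation : ∃ ι : UpperGroup ⧸ farSubgroup →* ∀ n : ℕ, Equiv.Perm (Fin n),
    Continuous ι ∧ Function.Injective ι := by
  have hK : ∀ k, IsOpen ((vanishing k ⊔ farSubgroup : Subgroup UpperGroup) : Set UpperGroup) :=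
    fun k => Subgroup.isOpen_mono le_sup_left (isOpen_vanishing k)
  have hfin : ∀ k, Finite (UpperGroup ⧸ (vanishing k ⊔ farSubgroup)) := fun k =>
    Subgroup.quotient_finite_of_isOpen _ (hK k)
  refine exists_injective_continuous (fun k => UpperGroup ⧸ (vanishing k ⊔ farSubgroup))
    (fun k => QuotientGroup.lift farSubgroup (MulAction.toPermHom UpperGroup _)
      fun x hx => toPermHom_eq_one_of_mem (le_sup_right (a := vanishing k) hx))
    (fun k => ?_) (fun r hr => ?_)
  · refine (QuotientGroup.isQuotientMap_mk (N := farSubgroup)).isOpen_preimage.1 ?_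
    have : IsOpen ((MulAction.toPermHom UpperGroup
        (UpperGroup ⧸ (vanishing k ⊔ farSubgroup))).ker : Set UpperGroup) :=
      Subgroup.isOpen_mono (fun x hx => toPermHom_eq_one_of_mem hx) (hK k)
    exact this
  · obtain ⟨x, rfl⟩ := QuotientGroup.mk_surjective r
    refine (QuotientGroup.eq_one_iff x).2 (mem_farSubgroup_of_forall fun k => ?_)
    exact mem_of_toPermHom_eq_one (hr k)

end UpperGroup

/-! ### The twisted cover and the split cover -/

theorem transClosure_map_coverGroup {M : Type} [partLang.Structure M] [IsGenericPart M]
    [Countable M] {H Q Y : Type} [Group H] [TopologicalSpace H] [IsTopologicalGroup H]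
    [CompactSpace H] {ρ : H →* ∀ n : ℕ, Equiv.Perm (Fin n)} {κ : H →* Equiv.Perm Q}
    (hρ : Continuous ρ) (hκ : IsOpen (κ.ker : Set H)) (e : M ⊕ Q ≃ Y) :
    transClosure ((coverGroup ρ κ M).map e.permCongrHom.toMonoidHom) =
      Set.range ((conjEnd e).toMonoidHom.comp (coverHom (M := M) ρ κ)) := by
  ext f
  obtain ⟨f, rfl⟩ := (conjEnd e).surjective f
  rw [mem_transClosure_map, transClosure_coverGroup hρ hκ]
  constructor
  · rintro ⟨p, rfl⟩
    exact ⟨p, rfl⟩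
  · rintro ⟨p, hp⟩
    exact ⟨p, (conjEnd e).injective hp⟩

/-- A group with a complemented central subgroup `F` is abstractly the product of the quotient
by `F` and `F`. -/
theorem exists_mulEquiv_quotient_prod {G : Type*} [Group G] {F D : Subgroup G} [F.Normal]
    (hF : F ≤ Subgroup.center G) (h : Subgroup.IsComplement' F D) :
    ∃ α : G ≃* (G ⧸ F) × F, ∀ x, (α x).1 = QuotientGroup.mk x := by
  have huniq : ∀ {c c' : F} {d d' : D}, (c : G) * d = c' * d' → c = c' := fun {c c' d d'} hcd =>
    congrArg Prod.fst (h.1 (a₁ := (c, d)) (a₂ := (c', d')) hcd)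
  choose p hp using fun x => h.2 x
  have hc : ∀ (c : F) (x : G), x * c = c * x := fun c => Subgroup.mem_center_iff.1 (hF c.2)
  let q : G →* F :=
    { toFun := fun x => (p x).1
      map_one' := huniq (d := (p 1).2) (d' := 1) (by simpa using hp 1)
      map_mul' := fun x y => huniq (d := (p (x * y)).2) (d' := (p x).2 * (p y).2) (by
        have h1 : ((p (x * y)).1 : G) * (p (x * y)).2 = x * y := hp _
        have h2 : ((p x).1 : G) * (p x).2 = x := hp _
        have h3 : ((p y).1 : G) * (p y).2 = y := hp _
        calc ((p (x * y)).1 : G) * (p (x * y)).2 = (p x).1 * ((p x).2 * (p y).1) * (p y).2 := by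
              rw [h1]
              nth_rewrite 1 [← h2, ← h3]
              group
          _ = _ := by
              rw [hc]
              push_cast
              group) }
  have hq : ∀ c : F, q c = c := fun c =>
    huniq (c := (p c).1) (d := (p c).2) (d' := 1) (by simpa using hp c)
  refine ⟨MulEquiv.ofBijective ((QuotientGroup.mk' F).prod q) ⟨?_, ?_⟩, fun x => rfl⟩
  · refine (injective_iff_map_eq_one _).2 fun x hx => ?_
    have h1 : x ∈ F := (QuotientGroup.eq_one_iff x).1 (congrArg Prod.fst hx)
    have h2 : q x = 1 := congrArg Prod.snd hx
    have h3 := hq ⟨x, h1⟩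
    rw [h2] at h3
    exact (congrArg Subtype.val h3).symm
  · rintro ⟨r, c⟩
    obtain ⟨y, rfl⟩ := QuotientGroup.mk_surjective r
    refine ⟨y * ((q y)⁻¹ * c : F), Prod.ext ?_ ?_⟩
    · exact (QuotientGroup.mk_mul_of_mem y ((q y)⁻¹ * c : F).2)
    · change q (y * ((q y)⁻¹ * c : F)) = c
      rw [map_mul, hq, mul_inv_cancel_left]

section Split

open FirstOrder.Language

variable {M : Type} [partLang.Structure M] {R F : Type} [Group R] [Group F]
  (ι : R →* ∀ n : ℕ, Equiv.Perm (Fin n))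

/-- The cover in which `R × F` acts on `F` through the second factor, as a product. -/
def encodingProdHom : encodingGroup M ι × F →*
    coverGroup (ι.comp (MonoidHom.fst R F))
      ((MulAction.toPermHom F F).comp (MonoidHom.snd R F)) M where
  toFun p := ⟨Equiv.sumCongr p.1.1 (MulAction.toPermHom F F p.2), by
    obtain ⟨r, hr⟩ := p.1.2
    exact ⟨p.1.1, (r, p.2), hr, rfl⟩⟩
  map_one' := by
    ext (x | x) <;> simp
  map_mul' p q := by
    ext (x | x) <;> simp [mul_assoc]

theorem encodingProdHom_bijective : Function.Bijective (encodingProdHom (M := M) (F := F) ι) := by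
  constructor
  · rintro ⟨⟨g, hg⟩, c⟩ ⟨⟨g', hg'⟩, c'⟩ h
    have h' : Equiv.sumCongr g (MulAction.toPermHom F F c) =
      Equiv.sumCongr g' (MulAction.toPermHom F F c') := congrArg Subtype.val h
    obtain rfl : g = g' := Equiv.ext fun x => Sum.inl_injective (Equiv.congr_fun h' (Sum.inl x))
    have hc : c * 1 = c' * 1 := Sum.inr_injective (Equiv.congr_fun h' (Sum.inr 1))
    obtain rfl : c = c' := by simpa using hc
    rfl
  · rintro ⟨_, g, ⟨r, c⟩, hg, rfl⟩
    exact ⟨(⟨g, r, hg⟩, c), rfl⟩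

theorem continuous_perm_apply {X : Type*} (x : X) :
    @Continuous _ X (Equiv.Perm.pointwiseTopology X) ⊥ fun g : Equiv.Perm X => g x :=
  let _ : TopologicalSpace X := ⊥
  (continuous_apply (A := fun _ : X => X) x).comp continuous_induced_dom

theorem continuous_perm_of_apply {X Z : Type*} [TopologicalSpace Z] {f : Z → Equiv.Perm X}
    (h : ∀ x, @Continuous Z X _ ⊥ fun z => f z x) : Continuous f :=
  let _ : TopologicalSpace X := ⊥
  continuous_induced_rng.2 (continuous_pi h)

variable [TopologicalSpace F] [DiscreteTopology F]

/-- The topological isomorphism between the split cover and the product of the encoding group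
with `F`. -/
noncomputable def encodingProdEquiv : encodingGroup M ι × F ≃ₜ*
    coverGroup (ι.comp (MonoidHom.fst R F))
      ((MulAction.toPermHom F F).comp (MonoidHom.snd R F)) M where
  toMulEquiv := MulEquiv.ofBijective _ (encodingProdHom_bijective ι)
  continuous_toFun := by
    let _ : TopologicalSpace M := ⊥
    have : DiscreteTopology M := ⟨rfl⟩
    refine continuous_induced_rng.2 (continuous_perm_of_apply ?_)
    let _ : TopologicalSpace (M ⊕ F) := ⊥
    rintro (x | x)
    · have h := (continuous_perm_apply x).comp
        (continuous_subtype_val.comp (continuous_fst (X := encodingGroup M ι) (Y := F)))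
      exact (continuous_of_discreteTopology (f := (Sum.inl : M → M ⊕ F))).comp h
    · exact (continuous_of_discreteTopology (f := fun c : F => (Sum.inr (c * x) : M ⊕ F))).comp
        continuous_snd
  continuous_invFun := by
    let _ : TopologicalSpace (M ⊕ F) := ⊥
    have hd : DiscreteTopology (M ⊕ F) := ⟨rfl⟩
    let E := MulEquiv.ofBijective _ (encodingProdHom_bijective (M := M) (F := F) ι)
    have hl : ∀ (q : coverGroup _ _ M) x,
        (q : Equiv.Perm (M ⊕ F)) (Sum.inl x) = Sum.inl ((E.symm q).1.1 x) := by
      intro q x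
      obtain ⟨p, rfl⟩ := E.surjective q
      rw [E.symm_apply_apply]
      rfl
    have hr : ∀ q : coverGroup _ _ M,
        (q : Equiv.Perm (M ⊕ F)) (Sum.inr 1) = Sum.inr (E.symm q).2 := by
      intro q
      obtain ⟨p, rfl⟩ := E.surjective q
      rw [E.symm_apply_apply]
      change Sum.inr (p.2 * 1) = _
      rw [mul_one]
    have heval : ∀ y : M ⊕ F, Continuous fun q : coverGroup (ι.comp (MonoidHom.fst R F))
        ((MulAction.toPermHom F F).comp (MonoidHom.snd R F)) M => (q : Equiv.Perm (M ⊕ F)) y :=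
      fun y => (continuous_perm_apply y).comp continuous_subtype_val
    refine Continuous.prodMk (continuous_induced_rng.2 (continuous_perm_of_apply fun x => ?_)) ?_
    · let _ : TopologicalSpace M := ⊥
      refine ((continuous_of_discreteTopology (f := fun y : M ⊕ F => y.elim id fun _ => x)).comp
        (heval (Sum.inl x))).congr fun q => ?_
      rw [Function.comp_apply, hl]
      rfl
    · refine ((continuous_of_discreteTopology (f := fun y : M ⊕ F => y.elim (fun _ => 1) id)).comp
        (heval (Sum.inr 1))).congr fun q => ?_
      rw [Function.comp_apply, hr]
      rfl

end Split

theorem nonempty_continuousMulEquiv_of_eq {G : Type*} [Group G] [TopologicalSpace G]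
    {A B : Subgroup G} (h : A = B) : Nonempty (A ≃ₜ* B) := by
  subst h
  exact ⟨ContinuousMulEquiv.refl _⟩

theorem theorem1 :
    ∃ (LA LB : FirstOrder.Language.{0, 0}) (_ : LA.Structure ℕ) (_ : LB.Structure ℕ),
      -- two countable omega-categorical structures in countable relational languages
      LA.IsRelational ∧ LB.IsRelational ∧ Countable LA.Symbols ∧ Countable LB.Symbols ∧
      IsOmegaCategorical LA ℕ ∧ IsOmegaCategorical LB ℕ ∧
      -- the endomorphism monoids are isomorphic, but not topologically isomorphic
      Nonempty (endMonoid LA ℕ ≃* endMonoid LB ℕ) ∧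
      ¬ Nonempty (endMonoid LA ℕ ≃ₜ* endMonoid LB ℕ) ∧
      -- they are the closures of two closed oligomorphic groups, the automorphism groups, which
      -- are isomorphic, but not topologically isomorphic
      ∃ Γ Δ : Subgroup (Equiv.Perm ℕ),
        IsClosed (Γ : Set (Equiv.Perm ℕ)) ∧ IsClosed (Δ : Set (Equiv.Perm ℕ)) ∧
        IsOligomorphic Γ ∧ IsOligomorphic Δ ∧
        autGroup LA ℕ = Γ ∧ autGroup LB ℕ = Δ ∧
        (endMonoid LA ℕ : Set (Function.End ℕ)) = transClosure Γ ∧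
        (endMonoid LB ℕ : Set (Function.End ℕ)) = transClosure Δ ∧
        Nonempty (Γ ≃* Δ) ∧ ¬ Nonempty (Γ ≃ₜ* Δ) ∧
        -- the two groups are built from a separable profinite group
        ∃ (G : ProfiniteGrp.{0}) (F F' G₀ : Subgroup G) (_ : F.Normal)
          (ι : G ⧸ F →* ∀ n : ℕ, Equiv.Perm (Fin n)) (_ : partLang.Structure ℕ)
          (e : ℕ ⊕ (G ⧸ G₀) ≃ ℕ),
          SecondCountableTopology G ∧ IsDenselyComplemented F F' ∧
          IsOpen (G₀ : Set G) ∧ G₀.Normal ∧ G₀ ⊓ F = ⊥ ∧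
          Continuous ι ∧ Function.Injective ι ∧
          FirstOrder.Language.IsFraisseLimit partClass ℕ ∧
          (Γ : Set (Equiv.Perm ℕ)) =
            closure ((twistedGroup ℕ F F' G₀ ι).map e.permCongrHom.toMonoidHom :
              Set (Equiv.Perm ℕ)) ∧
          Nonempty (Δ ≃ₜ* (encodingGroup ℕ ι × F)) := by
  obtain ⟨S, hS⟩ := exists_isGenericPart
  obtain ⟨D, hD⟩ := UpperGroup.exists_isDenselyComplemented
  obtain ⟨ι, hι, hιi⟩ := UpperGroup.exists_representation
  let F : Subgroup UpperGroup := UpperGroup.farSubgroup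
  let G₀ : Subgroup UpperGroup := UpperGroup.vanishing 2
  have hG₀ : IsOpen (G₀ : Set UpperGroup) := UpperGroup.isOpen_vanishing 2
  have hF : Finite F := hD.finite
  have hFn : Nontrivial F := (Subgroup.nontrivial_iff_ne_bot F).2 hD.nontrivial
  have hfinQ : Finite (UpperGroup ⧸ G₀) := Subgroup.quotient_finite_of_isOpen _ hG₀
  -- the twisted cover: `G` acts on the cosets of `G₀`
  let ρA : UpperGroup →* ∀ n : ℕ, Equiv.Perm (Fin n) := ι.comp (QuotientGroup.mk' F)
  let κA : UpperGroup →* Equiv.Perm (UpperGroup ⧸ G₀) := MulAction.toPermHom _ _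
  have hρA : Continuous ρA := hι.comp QuotientGroup.continuous_mk
  have hκA : IsOpen (κA.ker : Set UpperGroup) :=
    Subgroup.isOpen_mono (fun x hx => toPermHom_eq_one_of_mem hx) hG₀
  have hkerA : ∀ h, ρA h = 1 → κA h = 1 → h = 1 := by
    intro h h1 h2
    have hF' : h ∈ F := (QuotientGroup.eq_one_iff h).1 (hιi (h1.trans (map_one ι).symm))
    have : h ∈ G₀ ⊓ F := ⟨mem_of_toPermHom_eq_one h2, hF'⟩
    rwa [show G₀ ⊓ F = ⊥ from UpperGroup.vanishing_inf_farSubgroup] at this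
  -- the split cover: `(G ⧸ F) × F` acts on `F` through the second factor
  let ρB : (UpperGroup ⧸ F) × F →* ∀ n : ℕ, Equiv.Perm (Fin n) := ι.comp (MonoidHom.fst _ _)
  let κB : (UpperGroup ⧸ F) × F →* Equiv.Perm F :=
    (MulAction.toPermHom F F).comp (MonoidHom.snd _ _)
  have hρB : Continuous ρB := hι.comp continuous_fst
  have hκB : IsOpen (κB.ker : Set ((UpperGroup ⧸ F) × F)) :=
    (isOpen_discrete ((MulAction.toPermHom F F).ker : Set F)).preimage continuous_snd
  have hkerB : ∀ h, ρB h = 1 → κB h = 1 → h = 1 := by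
    rintro ⟨r, c⟩ h1 h2
    have hc : c * 1 = 1 := Equiv.congr_fun h2 1
    exact Prod.ext (hιi (h1.trans (map_one ι).symm)) (by simpa using hc)
  obtain ⟨eA⟩ : Nonempty (ℕ ⊕ (UpperGroup ⧸ G₀) ≃ ℕ) := nonempty_equiv_of_countable
  obtain ⟨eB⟩ : Nonempty (ℕ ⊕ F ≃ ℕ) := nonempty_equiv_of_countable
  let Γ : Subgroup (Equiv.Perm ℕ) := (coverGroup ρA κA ℕ).map eA.permCongrHom.toMonoidHom
  let Δ : Subgroup (Equiv.Perm ℕ) := (coverGroup ρB κB ℕ).map eB.permCongrHom.toMonoidHom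
  have hΓ : IsClosed (Γ : Set (Equiv.Perm ℕ)) :=
    isClosed_map_permCongr eA (isClosed_coverGroup hρA hκA)
  have hΔ : IsClosed (Δ : Set (Equiv.Perm ℕ)) :=
    isClosed_map_permCongr eB (isClosed_coverGroup hρB hκB)
  have hΓo : IsOligomorphic Γ := isOligomorphic_map_permCongr eA (isOligomorphic_coverGroup ρA κA)
  have hΔo : IsOligomorphic Δ := isOligomorphic_map_permCongr eB (isOligomorphic_coverGroup ρB κB)
  -- the abstract isomorphism of the monoids comes from `G ≃* (G ⧸ F) × F` over `G ⧸ F`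
  obtain ⟨α, hα⟩ := exists_mulEquiv_quotient_prod hD.central hD.complement
  let φA := mulEquivOfRange ((conjEnd eA).toMonoidHom.comp (coverHom (M := ℕ) ρA κA))
    ((conjEnd eA).injective.comp (coverHom_injective ρA κA hkerA)) (endMonoid (orbitLang Γ) ℕ)
    (endMonoid_orbit.trans (transClosure_map_coverGroup hρA hκA eA))
  let φB := mulEquivOfRange ((conjEnd eB).toMonoidHom.comp (coverHom (M := ℕ) ρB κB))
    ((conjEnd eB).injective.comp (coverHom_injective ρB κB hkerB)) (endMonoid (orbitLang Δ) ℕ)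
    (endMonoid_orbit.trans (transClosure_map_coverGroup hρB hκB eB))
  let φ : endMonoid (orbitLang Γ) ℕ ≃* endMonoid (orbitLang Δ) ℕ :=
    (φA.symm.trans (fiberMonoidCongr ρA ρB α fun h => congrArg ι (hα h))).trans φB
  -- topologically, `Δ` is a product with `F`, and `Γ` is not
  have hΔp : Nonempty (Δ ≃ₜ* encodingGroup ℕ ι × F) :=
    ⟨(mapPermCongrEquiv eB (coverGroup ρB κB ℕ)).symm.trans (encodingProdEquiv ι).symm⟩
  have hnot : ¬ Nonempty (Γ ≃ₜ* Δ) := fun ⟨ψ⟩ =>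
    (isEmpty_coverGroup_equiv_prod (M := ℕ) ρA κA hρA hκA hkerA hD.dense_of_complement
      (T := encodingGroup ℕ ι) (F := F) fun a b => Subtype.ext
        (Subgroup.mem_center_iff.1 (hD.central b.2) a)).false
      (((mapPermCongrEquiv eA (coverGroup ρA κA ℕ)).trans ψ).trans hΔp.some)
  refine ⟨orbitLang Γ, orbitLang Δ, orbitStructure Γ, orbitStructure Δ, isRelational_orbitLang Γ,
    isRelational_orbitLang Δ, countable_orbitLang hΓo, countable_orbitLang hΔo,
    isOmegaCategorical_orbit hΓo, isOmegaCategorical_orbit hΔo, ⟨φ⟩, ?_, Γ, Δ, hΓ, hΔ, hΓo, hΔo,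
    autGroup_orbit hΓ, autGroup_orbit hΔ, endMonoid_orbit, endMonoid_orbit, ?_, hnot,
    ProfiniteGrp.of UpperGroup, F, D, G₀, inferInstanceAs UpperGroup.farSubgroup.Normal, ι, S, eA,
    inferInstanceAs (SecondCountableTopology UpperGroup), hD, hG₀,
    inferInstanceAs (UpperGroup.vanishing 2).Normal, UpperGroup.vanishing_inf_farSubgroup, hι, hιi,
    isFraisseLimit_of_isGenericPart, ?_, hΔp⟩
  · rintro ⟨ψ⟩
    exact hnot ⟨((nonempty_continuousMulEquiv_of_eq (autGroup_orbit hΓ)).some.symm.trans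
      (autGroupContinuousEquiv ψ)).trans
      (nonempty_continuousMulEquiv_of_eq (autGroup_orbit hΔ)).some⟩
  · exact ⟨((MulEquiv.subgroupCongr (autGroup_orbit hΓ)).symm.trans (autGroupEquiv φ)).trans
      (MulEquiv.subgroupCongr (autGroup_orbit hΔ))⟩
  · rw [closure_map_permCongr]
    exact congrArg (eA.permCongr '' ·) (closure_perm_cover (M := ℕ) hρA hκA hD.dense).symm
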